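/- A (possibly promise) data structure problem with queries $X$, databases $Y$ and a partial answer function $f$ on $X\times Y$ has $(s,w,t)$-certificates if every database $y$ can be encoded as a table $T_y$ of $s$ cells of $w$ bits each such that for every query $x$ and database $y$ with $f(x,y)$ defined there is a set $P$ of exactly $t$ cells such that $f(x,y')=f(x,y)$ for every database $y'$ with $f(x,y')$ defined and $T_{y'}(i)=T_y(i)$ for all $i\in P$. For $\alpha>1$, the $\alpha$-approximate distance oracle problem for a class of undirected unweighted graphs on $n$ vertices has the graphs $G$ of the class as databases and triples $(u,v,\tilde d)$ of two vertices and a positive integer as queries; the answer is "yes" if $d_G(u,v)\le\tilde d$, "no" if $d_G(u,v)\ge\alpha\tilde d$ (where $d_G(u,v)=\infty$ if $u,v$ are not connected), and undefined otherwise. **Theorem.** There are an absolute constant $c>0$ and a fixed real polynomial $p$ such that the following holds for all $\alpha=\alpha(n)>1$ and $w=w(n)$ with $$\alpha=o\!\left(\frac{\log n}{\log (w\log n)}\right).$$ For all sufficiently large $n$ and all $s,t$: if the $\alpha$-approximate distance oracle problem for graphs on $n$ vertices has $(s,w,t)$-certificates, then $s\log n>n$ and $$t\ \ge\ c\cdot\frac{\log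 n}{\alpha\,\log\left(\frac{s\log n}{n}\right)} .$$ The same conclusion holds already if the problem restricted to the graphs on $n$ vertices of maximum degree at most $p\!\left(\frac{tw\alpha}{\log n}\right)$ has $(s,w,t)$-certificates. -/

import Mathlib

open Filter Asymptotics

/-- `(s, w, t)`-certificates for a data structure problem with query set `X`, database set `Y` and
answers in `Z`. The problem may be a promise problem: `f x y = some z` means that `z` is the answer
to query `x` on database `y`, and `f x y = none` means that the pair `(x, y)` violates the promise
(a problem `f : X → Y → Z` without a promise is `fun x y => some (f x y)`).
Every database `y` is encoded as a table `T y` of `s` cells of `w` bits each; for every query `x`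
and database `y` meeting the promise there are `t` cells whose contents determine the answer
to `x` among all databases `y'` meeting the promise. -/
def HasCertificates {X Y Z : Type*} (f : X → Y → Option Z) (s w t : ℕ) : Prop :=
  ∃ T : Y → Fin s → (Fin w → Bool),
    ∀ (x : X) (y : Y), f x y ≠ none →
      ∃ P : Finset (Fin s), P.card = t ∧
        ∀ y' : Y, f x y' ≠ none → (∀ i ∈ P, T y' i = T y i) → f x y' = f x y

open Classical in
/-- The `α`-approximate distance oracle problem for the databases in a class `𝒢` of simple graphs
on `n` vertices: on a query `(u, v, d)` with a threshold `d ≥ 1` the answer is "yes" if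
`dist_G(u, v) ≤ d` and "no" if `dist_G(u, v) ≥ α * d`; the remaining pairs violate the promise.
The distance is `⊤` between vertices in different components. -/
noncomputable def approxDistanceOracle {n : ℕ} (α : ℝ) (𝒢 : Set (SimpleGraph (Fin n))) :
    Fin n × Fin n × ℕ+ → 𝒢 → Option Bool :=
  fun q G =>
    if G.1.edist q.1 q.2.1 ≤ ((q.2.2 : ℕ) : ℕ∞) then some true
    else if ENNReal.ofReal (α * ((q.2.2 : ℕ) : ℝ)) ≤ (G.1.edist q.1 q.2.1 : ENNReal) then some false
    else none

/-- The graphs on `n` vertices all of whose degrees are at most `Δ`. -/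
def boundedDegreeGraphs (n : ℕ) (Δ : ℝ) : Set (SimpleGraph (Fin n)) :=
  {G | ∀ v, ((G.neighborSet v).ncard : ℝ) ≤ Δ}

/-!
The hard instances are the subgraphs of one graph `E` with `l + 1` layers of `N` vertices, whose
edges join consecutive layers and which is nearly `b`-regular upwards and downwards. Its girth
exceeds `(α + 1) * l`. So if a walk from the first to the last layer is contained in a
subgraph, its ends have distance at most `l`, whereas they have distance at least `α * l` as soon as
one edge of the walk is missing (`IsWalk.le_edist_of_notMem`). Such a graph exists with `l` of order
`log n / (α * log b)`: a graph that is maximal subject to the bounds for degrees and girth will do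
(`exists_layered_hasLongDetours`).

Consider systems `x` of `m` vertex-disjoint walks, with `Q = m * l` edges together. There are at
least `(N * b ^ l / 4) ^ m` of them (`pow_le_card_walkSystem`), but a set of `u` edges contains at
most `N ^ m * (u / Q) ^ Q` (`card_walkSystem_le`). If `x` lies in a subgraph `y`, the certificates
for the `m` queries about the ends of the walks together consist of `k ≤ min (t * m) s` cells, and
`x` lies in each subgraph whose table agrees with that of `y` on these cells. For a fixed set of
cells, the subgraphs fall into at most `2 ^ (w * k)` classes by their contents. All subgraphs of a
class contain the union `U` of the systems certified for it, so the class is negligible unless `U`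
has at most about `w * k + 2 * Q` edges, and then few systems are certified. Summing over the sets
of cells shows that a set of cells certifies at most a fraction
`O(w * k / Q + 1) ^ Q / b ^ Q` of all systems, so there must be at least `b ^ (Q / 2)` sets of at
most `k` cells if `b` is a suitable power of `w * k / Q + 1`
(`card_le_of_certificates`, `pow_le_card_positions`).

As there are at most `(e * s / k) ^ k` such sets and `Q` is at least `n / log n`, this yields
`t * log (s * log n / n) ≥ (l / 4) * log b`, which is of order `log n / α`
(`mul_log_le_of_exp_le_card`, `lower_bound_of_exp_le_card`).
-/

/-! ### Counting certificates -/

/-- Beyond `2 * Q`, the function `u ↦ (u / Q) ^ Q / 2 ^ u` is decreasing. -/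
theorem pow_div_le_mul_two_pow {Q Z d : ℕ} (hQ : 0 < Q) (hZ : 2 * Q ≤ Z) :
    ((Z + d : ℕ) / Q : ℝ) ^ Q ≤ ((Z : ℝ) / Q) ^ Q * 2 ^ d := by
  have hQ' : (0 : ℝ) < Q := by exact_mod_cast hQ
  have hZ' : (2 * Q : ℝ) ≤ Z := by exact_mod_cast hZ
  have hZ0 : (0 : ℝ) < Z := by linarith
  have h1 : ((Z + d : ℕ) / Q : ℝ) = (Z : ℝ) / Q * (1 + d / Z) := by
    push_cast; field_simp
  have hd : (0 : ℝ) ≤ d := d.cast_nonneg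
  rw [h1, mul_pow]
  refine mul_le_mul_of_nonneg_left ?_ (by positivity)
  calc (1 + (d : ℝ) / Z) ^ Q ≤ (Real.exp (d / Z)) ^ Q := by
        gcongr
        linarith [Real.add_one_le_exp ((d : ℝ) / Z)]
    _ = Real.exp (Q * (d / Z)) := by rw [← Real.exp_nat_mul]
    _ ≤ Real.exp (d * (1 / 2)) := by
        apply Real.exp_le_exp.2
        rw [mul_div_assoc', div_le_iff₀ hZ0]
        nlinarith
    _ = Real.exp (1 / 2) ^ d := by rw [← Real.exp_nat_mul]
    _ ≤ 2 ^ d := by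
        gcongr
        have h2 : Real.exp (1 / 2) * Real.exp (1 / 2) = Real.exp 1 := by
          rw [← Real.exp_add]; norm_num
        have h3 := Real.exp_one_lt_d9
        nlinarith [Real.exp_pos (1 / 2)]

/-- One class of databases, namely those sharing the contents of a fixed set of cells. All of them
contain `U`; if `U` is large, the class is so small that it makes up for the many families of
paths inside `U`. -/
theorem card_mul_pow_le {κ : Type*} [DecidableEq κ] {E U : Finset κ} {C : Finset (Finset κ)}
    {Q Z : ℕ} (hQ : 0 < Q) (hZ : 2 * Q ≤ Z) (hU : U ⊆ E) (hC : C ⊆ Finset.Icc U E) :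
    (C.card : ℝ) * ((U.card : ℝ) / Q) ^ Q ≤
      (C.card + 2 ^ E.card / 2 ^ Z) * ((Z : ℝ) / Q) ^ Q := by
  rcases le_or_gt U.card Z with h | h
  · have : ((U.card : ℝ) / Q) ^ Q ≤ ((Z : ℝ) / Q) ^ Q := by gcongr
    have h2 : (C.card : ℝ) ≤ C.card + 2 ^ E.card / 2 ^ Z := by
      have : (0 : ℝ) ≤ 2 ^ E.card / 2 ^ Z := by positivity
      linarith
    gcongr
  · obtain ⟨d, hd⟩ := Nat.exists_eq_add_of_le h.le
    have h1 : (C.card : ℝ) ≤ 2 ^ E.card / 2 ^ U.card := by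
      rw [le_div_iff₀ (by positivity)]
      have h2 := Finset.card_le_card hC
      rw [Finset.card_Icc_finset hU] at h2
      calc (C.card : ℝ) * 2 ^ U.card ≤ ((2 ^ (E.card - U.card) : ℕ) : ℝ) * 2 ^ U.card := by
            gcongr
        _ = 2 ^ E.card := by
            push_cast
            rw [← pow_add, Nat.sub_add_cancel (Finset.card_le_card hU)]
    calc (C.card : ℝ) * ((U.card : ℝ) / Q) ^ Q
        ≤ 2 ^ E.card / 2 ^ U.card * (((Z : ℝ) / Q) ^ Q * 2 ^ d) := by
          gcongr
          rw [hd]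
          exact pow_div_le_mul_two_pow hQ hZ
      _ = 2 ^ E.card / 2 ^ Z * ((Z : ℝ) / Q) ^ Q := by
          rw [hd, pow_add]; field_simp
      _ ≤ _ := by
          gcongr
          have : (0 : ℝ) ≤ C.card := by positivity
          linarith

open Classical in
/-- The counting core. Here `ι` is a family of sets `ed X ⊆ E` of `Q` elements each, and every
inclusion `ed X ⊆ y` is certified by at most `k` cells of the table of `y`. If a set of `u` elements
contains at most `R * (u / Q) ^ Q` of the sets `ed X`, then the number of possible
positions of the certificates is large. -/
theorem card_le_of_certificates {ι κ : Type*} [Fintype ι] [DecidableEq κ] {E : Finset κ}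
    {ed : ι → Finset κ} {s w k Q Z : ℕ} {R : ℝ} (hR : 0 ≤ R) (hQ : 0 < Q) (hZ : 2 * Q ≤ Z) (hwk : w * k ≤ Z)
    (hcard : ∀ X, (ed X).card = Q) (hE : ∀ X, ed X ⊆ E)
    (T : Finset κ → Fin s → (Fin w → Bool))
    (hcert : ∀ X, ∀ y ⊆ E, ed X ⊆ y → ∃ P : Finset (Fin s), P.card ≤ k ∧
      ∀ y' ⊆ E, (∀ i ∈ P, T y' i = T y i) → ed X ⊆ y')
    (hgrow : ∀ U ⊆ E, ((Finset.univ.filter fun X => ed X ⊆ U).card : ℝ) ≤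
      R * ((U.card : ℝ) / Q) ^ Q) :
    (Fintype.card ι : ℝ) ≤ 2 * 2 ^ Q *
      (Finset.univ.filter fun P : Finset (Fin s) => P.card ≤ k).card *
        (R * ((Z : ℝ) / Q) ^ Q) := by
  set F := Finset.univ.filter fun P : Finset (Fin s) => P.card ≤ k with hF
  have hc : ∀ X y, ∃ P : Finset (Fin s), P.card ≤ k ∧ (y ⊆ E → ed X ⊆ y →
      ∀ y' ⊆ E, (∀ i ∈ P, T y' i = T y i) → ed X ⊆ y') := by
    intro X y
    by_cases h : y ⊆ E ∧ ed X ⊆ y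
    · obtain ⟨P, h1, h2⟩ := hcert X y h.1 h.2
      exact ⟨P, h1, fun _ _ => h2⟩
    · exact ⟨∅, by simp, fun h1 h2 => (h ⟨h1, h2⟩).elim⟩
  choose c hck hc using hc
  set H : ℝ := R * ((Z : ℝ) / Q) ^ Q with hH
  have hH0 : 0 ≤ H := by positivity
  let A : Finset (Fin s) → Finset κ → Finset ι := fun P y =>
    Finset.univ.filter fun X => ed X ⊆ y ∧ c X y = P
  -- all databases together, for a fixed set of cells
  have hP : ∀ P ∈ F, ∑ y ∈ E.powerset, ((A P y).card : ℝ) ≤ 2 * 2 ^ E.card * H := by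
    intro P hP
    have hPk : P.card ≤ k := by simpa [hF] using hP
    let r : Finset κ → (P → Fin w → Bool) := fun y i => T y i
    let C : (P → Fin w → Bool) → Finset (Finset κ) := fun σ => E.powerset.filter fun y => r y = σ
    have hσ : ∀ σ, ∑ y ∈ C σ, ((A P y).card : ℝ) ≤ ((C σ).card + 2 ^ E.card / 2 ^ Z) * H := by
      intro σ
      let U : Finset κ := (C σ).biUnion fun y => (A P y).biUnion ed
      have hUE : U ⊆ E := by
        intro e he
        simp only [U, Finset.mem_biUnion] at he
        obtain ⟨y, -, X, -, he⟩ := he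
        exact hE X he
      have hCU : C σ ⊆ Finset.Icc U E := by
        intro y' hy'
        have hy'2 : y' ⊆ E ∧ r y' = σ := by simpa [C] using hy'
        rw [Finset.mem_Icc]
        refine ⟨?_, hy'2.1⟩
        intro e he
        simp only [U, Finset.mem_biUnion] at he
        obtain ⟨y, hy, X, hX, he⟩ := he
        have hy2 : y ⊆ E ∧ r y = σ := by simpa [C] using hy
        have hX2 : ed X ⊆ y ∧ c X y = P := by simpa [A] using hX
        refine hc X y hy2.1 hX2.1 y' hy'2.1 ?_ he
        rw [hX2.2]
        intro i hi
        exact congrFun (hy'2.2.trans hy2.2.symm) ⟨i, hi⟩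
      calc ∑ y ∈ C σ, ((A P y).card : ℝ)
          ≤ ∑ y ∈ C σ, R * ((U.card : ℝ) / Q) ^ Q := by
            refine Finset.sum_le_sum fun y hy => le_trans ?_ (hgrow U hUE)
            gcongr
            intro X hX
            simp only [Finset.mem_filter, Finset.mem_univ, true_and]
            intro e he
            simp only [U, Finset.mem_biUnion]
            exact ⟨y, hy, X, hX, he⟩
        _ = R * ((C σ).card * ((U.card : ℝ) / Q) ^ Q) := by
            rw [Finset.sum_const, nsmul_eq_mul]; ring
        _ ≤ R * (((C σ).card + 2 ^ E.card / 2 ^ Z) * ((Z : ℝ) / Q) ^ Q) := by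
            gcongr R * ?_
            exact card_mul_pow_le hQ hZ hUE hCU
        _ = _ := by rw [hH]; ring
    have hsum : ∑ σ, ((C σ).card : ℝ) = 2 ^ E.card := by
      have := Finset.card_eq_sum_card_fiberwise (f := r) (s := E.powerset)
        (t := Finset.univ) (fun _ _ => Finset.mem_coe.2 (Finset.mem_univ _))
      rw [Finset.card_powerset] at this
      exact_mod_cast this.symm
    calc ∑ y ∈ E.powerset, ((A P y).card : ℝ)
        = ∑ σ, ∑ y ∈ C σ, ((A P y).card : ℝ) := (Finset.sum_fiberwise _ _ _).symm
      _ ≤ ∑ σ, ((C σ).card + 2 ^ E.card / 2 ^ Z) * H := Finset.sum_le_sum fun σ _ => hσ σ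
      _ = (2 ^ E.card + 2 ^ (w * P.card) * (2 ^ E.card / 2 ^ Z)) * H := by
          rw [← Finset.sum_mul, Finset.sum_add_distrib, hsum, Finset.sum_const, nsmul_eq_mul]
          simp [pow_mul]
      _ ≤ (2 ^ E.card + 2 ^ Z * (2 ^ E.card / 2 ^ Z)) * H := by
          gcongr
          · norm_num
          · exact (Nat.mul_le_mul_left w hPk).trans hwk
      _ = _ := by
          rw [mul_div_cancel₀ _ (by positivity)]; ring
  have hcount : ∑ y ∈ E.powerset, ∑ P ∈ F, ((A P y).card : ℝ) =
      ∑ X : ι, (2 : ℝ) ^ (E.card - Q) := by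
    have h1 : ∀ y ∈ E.powerset, ∑ P ∈ F, ((A P y).card : ℝ) =
        ∑ X : ι, if ed X ⊆ y then (1 : ℝ) else 0 := by
      intro y _
      have := Finset.card_eq_sum_card_fiberwise (f := fun X => c X y)
        (s := Finset.univ.filter fun X => ed X ⊆ y) (t := F)
        (fun X _ => by simpa [hF] using hck X y)
      rw [Finset.sum_boole, this]
      push_cast
      refine Finset.sum_congr rfl fun P _ => ?_
      simp only [A, Finset.filter_filter]
    rw [Finset.sum_congr rfl h1, Finset.sum_comm]
    refine Finset.sum_congr rfl fun X _ => ?_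
    rw [Finset.sum_boole]
    have : (E.powerset.filter fun y => ed X ⊆ y) = Finset.Icc (ed X) E := by
      ext y
      simp [Finset.mem_Icc, and_comm]
    rw [this, Finset.card_Icc_finset (hE X), hcard X]
    push_cast; rfl
  have hmain : (Fintype.card ι : ℝ) * 2 ^ (E.card - Q) ≤ F.card * (2 * 2 ^ E.card * H) := by
    calc (Fintype.card ι : ℝ) * 2 ^ (E.card - Q) = ∑ X : ι, (2 : ℝ) ^ (E.card - Q) := by
          rw [Finset.sum_const, nsmul_eq_mul, Finset.card_univ]
      _ = ∑ P ∈ F, ∑ y ∈ E.powerset, ((A P y).card : ℝ) := by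
          rw [← hcount, Finset.sum_comm]
      _ ≤ ∑ P ∈ F, 2 * 2 ^ E.card * H := Finset.sum_le_sum hP
      _ = _ := by rw [Finset.sum_const, nsmul_eq_mul]
  rcases isEmpty_or_nonempty ι with hι | ⟨⟨X⟩⟩
  · rw [Fintype.card_eq_zero]
    push_cast
    positivity
  · have hQE : Q ≤ E.card := hcard X ▸ Finset.card_le_card (hE X)
    have h2 : (2 : ℝ) ^ E.card = 2 ^ (E.card - Q) * 2 ^ Q := by
      rw [← pow_add, Nat.sub_add_cancel hQE]
    rw [h2] at hmain
    have h3 : (0 : ℝ) < 2 ^ (E.card - Q) := by positivity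
    refine le_of_mul_le_mul_right ?_ h3
    calc _ ≤ _ := hmain
      _ = _ := by ring

/-- The number of sets of at most `k` out of `s` elements is at most `(e s / k) ^ k`. -/
theorem card_filter_card_le_le_exp {s k : ℕ} (hk : 0 < k) (hks : k ≤ s) :
    ((Finset.univ.filter fun P : Finset (Fin s) => P.card ≤ k).card : ℝ) ≤
      Real.exp (k * (1 + Real.log (s / k))) := by
  have hk' : (0 : ℝ) < k := by exact_mod_cast hk
  have hs' : (0 : ℝ) < s := by exact_mod_cast hk.trans_le hks
  set x : ℝ := k / s with hx
  have hx0 : 0 < x := by positivity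
  have hx1 : x ≤ 1 := by
    rw [hx, div_le_one hs']; exact_mod_cast hks
  have h1 : ((Finset.univ.filter fun P : Finset (Fin s) => P.card ≤ k).card : ℝ) * x ^ k ≤
      Real.exp k := by
    calc _ = ∑ P ∈ Finset.univ.filter fun P : Finset (Fin s) => P.card ≤ k, x ^ k := by
          rw [Finset.sum_const, nsmul_eq_mul]
      _ ≤ ∑ P ∈ Finset.univ.filter fun P : Finset (Fin s) => P.card ≤ k, x ^ P.card := by
          refine Finset.sum_le_sum fun P hP => ?_
          exact pow_le_pow_of_le_one hx0.le hx1 (by simpa using hP)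
      _ ≤ ∑ P : Finset (Fin s), x ^ P.card :=
          Finset.sum_le_sum_of_subset_of_nonneg (Finset.filter_subset _ _)
            fun _ _ _ => by positivity
      _ = (x + 1) ^ s := by
          have := Finset.sum_pow_mul_eq_add_pow x 1 (Finset.univ : Finset (Fin s))
          simpa using this
      _ ≤ Real.exp x ^ s := by
          gcongr
          exact Real.add_one_le_exp x
      _ = Real.exp k := by
          rw [← Real.exp_nat_mul, hx, mul_div_cancel₀ _ hs'.ne']
  have h2 : Real.exp (k * (1 + Real.log (s / k))) * x ^ k = Real.exp k := by
    have : Real.log (s / k) = -Real.log x := by rw [hx, ← Real.log_inv, inv_div]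
    rw [← Real.exp_log (pow_pos hx0 k), ← Real.exp_add, Real.log_pow, this]
    congr 1; ring
  rw [← h2] at h1
  exact le_of_mul_le_mul_right h1 (by positivity)

/-! ### Walks in layered digraphs -/

/-- The weight of a sequence of vertices for a transition matrix `a`. For the adjacency matrix of a
digraph this is the indicator function of walks. -/
def walkWeight {V : Type*} (a : V → V → ℝ) {l : ℕ} (p : Fin (l + 1) → V) : ℝ :=
  ∏ j : Fin l, a (p j.castSucc) (p j.succ)

/-- `p` is a walk of length `l` in the digraph with edge set `E`. -/
def IsWalk {V : Type*} (E : Finset (V × V)) {l : ℕ} (p : Fin (l + 1) → V) : Prop :=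
  ∀ j : Fin l, (p j.castSucc, p j.succ) ∈ E

/-- The digraph `E` is layered by `lay` with last layer `l`: each edge leads to the next layer. -/
def IsLayered {V : Type*} (lay : V → ℕ) (l : ℕ) (E : Finset (V × V)) : Prop :=
  ∀ e ∈ E, lay e.2 = lay e.1 + 1 ∧ lay e.2 ≤ l

/-- A family of `m` walks of length `l` no two of which are at the same vertex at the same time. -/
def IsWalkSystem {V : Type*} (E : Finset (V × V)) {m l : ℕ} (x : Fin m → Fin (l + 1) → V) : Prop :=
  (∀ i, IsWalk E (x i)) ∧ ∀ i i', i ≠ i' → ∀ j, x i j ≠ x i' j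

section Walks

variable {V : Type*}

theorem walkWeight_cons (a : V → V → ℝ) {l : ℕ} (v : V) (p : Fin (l + 1) → V) :
    walkWeight a (Fin.cons v p : Fin (l + 2) → V) = a v (p 0) * walkWeight a p := by
  unfold walkWeight
  rw [Fin.prod_univ_succ]
  simp

theorem walkWeight_nonneg {a : V → V → ℝ} (ha : ∀ u v, 0 ≤ a u v) {l : ℕ} (p : Fin (l + 1) → V) :
    0 ≤ walkWeight a p := Finset.prod_nonneg fun _ _ => ha _ _

theorem sum_fin_succ_eq_sum_cons [Fintype V] [DecidableEq V] {l : ℕ}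
    (F : (Fin (l + 2) → V) → ℝ) :
    ∑ p, F p = ∑ v, ∑ p : Fin (l + 1) → V, F (Fin.cons v p) := by
  rw [← Fintype.sum_prod_type']
  exact (Equiv.sum_comp (Fin.consEquiv fun _ => V) F).symm

/-- If all row sums of `a` are at most `r`, the sequences from `v` have total weight at most
`r ^ l`. -/
theorem sum_walkWeight_start_le [Fintype V] [DecidableEq V] {a : V → V → ℝ} {r : ℝ}
    (ha : ∀ u v, 0 ≤ a u v) (hr : 0 ≤ r) (hrow : ∀ u, ∑ v, a u v ≤ r) (l : ℕ) (v : V) :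
    ∑ p : Fin (l + 1) → V, (if p 0 = v then walkWeight a p else 0) ≤ r ^ l := by
  induction l generalizing v with
  | zero =>
    have h : ∀ p : Fin 1 → V, (if p 0 = v then walkWeight a p else 0) =
        if p = fun _ => v then 1 else 0 := by
      intro p
      have : p 0 = v ↔ p = fun _ => v := by
        constructor
        · intro h; funext i; rw [Subsingleton.elim i 0, h]
        · intro h; rw [h]
      simp [this, walkWeight]
    simp [h]
  | succ l ih =>
    rw [sum_fin_succ_eq_sum_cons]
    have h1 : ∀ u : V, (∑ p : Fin (l + 1) → V, if (Fin.cons u p : Fin (l + 2) → V) 0 = v then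
        walkWeight a (Fin.cons u p : Fin (l + 2) → V) else 0) =
        if u = v then ∑ p : Fin (l + 1) → V, a v (p 0) * walkWeight a p else 0 := by
      intro u
      simp only [Fin.cons_zero, walkWeight_cons]
      split_ifs with h <;> simp [h]
    simp only [h1, Finset.sum_ite_eq', Finset.mem_univ, if_true]
    calc ∑ p : Fin (l + 1) → V, a v (p 0) * walkWeight a p
        = ∑ p : Fin (l + 1) → V, ∑ u, a v u * (if p 0 = u then walkWeight a p else 0) := by
          refine Finset.sum_congr rfl fun p _ => ?_
          simp
      _ = ∑ u, a v u * ∑ p : Fin (l + 1) → V, (if p 0 = u then walkWeight a p else 0) := by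
          rw [Finset.sum_comm]
          simp only [Finset.mul_sum]
      _ ≤ ∑ u, a v u * r ^ l :=
          Finset.sum_le_sum fun u _ => mul_le_mul_of_nonneg_left (ih u) (ha _ _)
      _ = (∑ u, a v u) * r ^ l := by rw [Finset.sum_mul]
      _ ≤ r * r ^ l := by gcongr; exact hrow v
      _ = r ^ (l + 1) := by ring

/-- If all row and column sums of `a` are at most `r`, the sequences that are at `v` at time `j` have
total weight at most `r ^ l`. -/
theorem sum_walkWeight_through_le [Fintype V] [DecidableEq V] {a : V → V → ℝ} {r : ℝ}
    (ha : ∀ u v, 0 ≤ a u v) (hr : 0 ≤ r) (hrow : ∀ u, ∑ v, a u v ≤ r)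
    (hcol : ∀ v, ∑ u, a u v ≤ r) (l : ℕ) (j : Fin (l + 1)) (v : V) :
    ∑ p : Fin (l + 1) → V, (if p j = v then walkWeight a p else 0) ≤ r ^ l := by
  induction l with
  | zero =>
    obtain rfl : j = 0 := Fin.eq_zero j
    exact sum_walkWeight_start_le ha hr hrow 0 v
  | succ l ih =>
    refine Fin.cases (sum_walkWeight_start_le ha hr hrow (l + 1) v) (fun j => ?_) j
    rw [sum_fin_succ_eq_sum_cons, Finset.sum_comm]
    simp only [Fin.cons_succ, walkWeight_cons]
    calc ∑ p : Fin (l + 1) → V, ∑ u, (if p j = v then a u (p 0) * walkWeight a p else 0)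
        = ∑ p : Fin (l + 1) → V, (∑ u, a u (p 0)) * (if p j = v then walkWeight a p else 0) := by
          refine Finset.sum_congr rfl fun p _ => ?_
          split_ifs <;> simp [Finset.sum_mul]
      _ ≤ ∑ p : Fin (l + 1) → V, r * (if p j = v then walkWeight a p else 0) := by
          refine Finset.sum_le_sum fun p _ => mul_le_mul_of_nonneg_right (hcol _) ?_
          split_ifs
          exacts [walkWeight_nonneg ha p, le_rfl]
      _ ≤ r * r ^ l := by
          rw [← Finset.mul_sum]
          exact mul_le_mul_of_nonneg_left (ih j) hr
      _ = r ^ (l + 1) := by ring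

theorem walkWeight_adj [DecidableEq V] (E : Finset (V × V)) {l : ℕ} (p : Fin (l + 1) → V)
    [Decidable (IsWalk E p)] :
    walkWeight (fun u v => if (u, v) ∈ E then (1 : ℝ) else 0) p = if IsWalk E p then 1 else 0 := by
  rw [walkWeight, Finset.prod_ite_zero]
  by_cases h : IsWalk E p
  · rw [if_pos h, if_pos fun i _ => h i]
    simp
  · rw [if_neg h, if_neg fun h' => h fun i => h' i (Finset.mem_univ i)]

/-- In a layered digraph of in- and outdegree at most `b` whose layers have `N` vertices and lack at
most `b * B` ingoing edges each, at least `b ^ l * (N - l * B)` walks of length `l` start in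
a given layer. -/
theorem le_sum_walkWeight_layer [Fintype V] [DecidableEq V] {E : Finset (V × V)} {lay : V → ℕ}
    {L b N : ℕ} {B : ℝ} (hE : IsLayered lay L E)
    (hN : ∀ j ≤ L, (Finset.univ.filter fun v => lay v = j).card = N)
    (hout : ∀ u, (Finset.univ.filter fun v => (u, v) ∈ E).card ≤ b)
    (hin : ∀ v, (Finset.univ.filter fun u => (u, v) ∈ E).card ≤ b)
    (hdef : ∀ j < L, ∑ v ∈ Finset.univ.filter (fun v => lay v = j + 1),
      ((b : ℝ) - (Finset.univ.filter fun u => (u, v) ∈ E).card) ≤ b * B)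
    (l j : ℕ) (hj : j + l ≤ L) :
    (b : ℝ) ^ l * (N - l * B) ≤ ∑ p : Fin (l + 1) → V, (if lay (p 0) = j then
      walkWeight (fun u v => if (u, v) ∈ E then (1 : ℝ) else 0) p else 0) := by
  set a : V → V → ℝ := fun u v => if (u, v) ∈ E then (1 : ℝ) else 0 with ha
  have ha0 : ∀ u v, 0 ≤ a u v := fun u v => by simp only [ha]; split_ifs <;> norm_num
  have hrow : ∀ u, ∑ v, a u v ≤ b := fun u => by
    simp only [ha]; rw [Finset.sum_boole]; exact_mod_cast hout u
  induction l generalizing j with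
  | zero =>
    have : ∑ p : Fin 1 → V, (if lay (p 0) = j then walkWeight a p else 0) =
        ∑ v : V, if lay v = j then (1 : ℝ) else 0 := by
      refine Fintype.sum_equiv (Equiv.funUnique (Fin 1) V) _ _ fun p => ?_
      simp [walkWeight]
    rw [this, Finset.sum_boole, hN j (by omega)]
    simp
  | succ l ih =>
    have hin' : ∀ v, lay v = j + 1 → ∑ u, (if lay u = j then a u v else 0) =
        (Finset.univ.filter fun u => (u, v) ∈ E).card := by
      intro v hv
      rw [← Finset.sum_boole]
      refine Finset.sum_congr rfl fun u _ => ?_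
      simp only [ha]
      by_cases h : (u, v) ∈ E
      · have := (hE _ h).1
        simp only [hv] at this
        rw [if_pos (by omega)]
      · simp [h]
    rw [sum_fin_succ_eq_sum_cons, Finset.sum_comm]
    simp only [Fin.cons_zero, walkWeight_cons]
    -- a walk from layer `j + 1` extends backwards in `b` ways, up to the deficiency of its start
    have h1 : ∀ p : Fin (l + 1) → V,
        (b : ℝ) * (if lay (p 0) = j + 1 then walkWeight a p else 0) -
          (if lay (p 0) = j + 1 then
            ((b : ℝ) - (Finset.univ.filter fun u => (u, p 0) ∈ E).card) * walkWeight a p else 0) ≤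
        ∑ u, (if lay u = j then a u (p 0) * walkWeight a p else 0) := by
      intro p
      have h2 : ∑ u, (if lay u = j then a u (p 0) * walkWeight a p else 0) =
          (∑ u, if lay u = j then a u (p 0) else 0) * walkWeight a p := by
        rw [Finset.sum_mul]
        refine Finset.sum_congr rfl fun u _ => ?_
        split_ifs <;> simp
      rw [h2]
      by_cases h : lay (p 0) = j + 1
      · rw [hin' _ h, if_pos h, if_pos h]
        apply le_of_eq; ring
      · rw [if_neg h, if_neg h]
        simp only [mul_zero, sub_zero]
        refine mul_nonneg (Finset.sum_nonneg fun u _ => ?_) (walkWeight_nonneg ha0 p)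
        split_ifs
        exacts [ha0 _ _, le_rfl]
    have h3 : ∑ p : Fin (l + 1) → V, (if lay (p 0) = j + 1 then
        ((b : ℝ) - (Finset.univ.filter fun u => (u, p 0) ∈ E).card) * walkWeight a p else 0) ≤
        b * B * b ^ l := by
      calc _ = ∑ p : Fin (l + 1) → V, ∑ v ∈ Finset.univ.filter (fun v => lay v = j + 1),
            ((b : ℝ) - (Finset.univ.filter fun u => (u, v) ∈ E).card) *
              (if p 0 = v then walkWeight a p else 0) := by
            refine Finset.sum_congr rfl fun p _ => ?_
            rw [Finset.sum_filter]
            simp only [mul_ite, mul_zero]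
            rw [Finset.sum_eq_single (p 0)]
            · simp
            · intro v _ hv
              simp [hv.symm]
            · simp
        _ = ∑ v ∈ Finset.univ.filter (fun v => lay v = j + 1),
            ((b : ℝ) - (Finset.univ.filter fun u => (u, v) ∈ E).card) *
              ∑ p : Fin (l + 1) → V, (if p 0 = v then walkWeight a p else 0) := by
            rw [Finset.sum_comm]
            simp only [Finset.mul_sum]
        _ ≤ ∑ v ∈ Finset.univ.filter (fun v => lay v = j + 1),
            ((b : ℝ) - (Finset.univ.filter fun u => (u, v) ∈ E).card) * (b : ℝ) ^ l := by
            refine Finset.sum_le_sum fun v _ => mul_le_mul_of_nonneg_left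
              (sum_walkWeight_start_le ha0 b.cast_nonneg hrow l v) ?_
            rw [sub_nonneg]; exact_mod_cast hin v
        _ ≤ b * B * b ^ l := by
            rw [← Finset.sum_mul]
            gcongr
            exact hdef j (by omega)
    calc (b : ℝ) ^ (l + 1) * (N - (l + 1 : ℕ) * B)
        = b * (b ^ l * (N - l * B)) - b * B * b ^ l := by push_cast; ring
      _ ≤ b * ∑ p : Fin (l + 1) → V, (if lay (p 0) = j + 1 then walkWeight a p else 0) -
          ∑ p : Fin (l + 1) → V, (if lay (p 0) = j + 1 then
            ((b : ℝ) - (Finset.univ.filter fun u => (u, p 0) ∈ E).card) * walkWeight a p else 0) := by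
          gcongr
          exact ih (j + 1) (by omega)
      _ ≤ _ := by
          rw [Finset.mul_sum, ← Finset.sum_sub_distrib]
          exact Finset.sum_le_sum fun p _ => h1 p

theorem IsWalk.lay_eq_add {E : Finset (V × V)} {lay : V → ℕ} {L l : ℕ} (hE : IsLayered lay L E)
    {p : Fin (l + 1) → V} (hp : IsWalk E p) (j : Fin (l + 1)) : lay (p j) = lay (p 0) + j := by
  induction j using Fin.induction with
  | zero => simp
  | succ j ih =>
    have := (hE _ (hp j)).1
    simp only at this
    rw [this, ih]
    simp [add_assoc]

/-- A walk as long as the number of layers allows has to start in layer `0`. -/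
theorem IsWalk.lay_eq {E : Finset (V × V)} {lay : V → ℕ} {l : ℕ} (hl : 0 < l)
    (hE : IsLayered lay l E) {p : Fin (l + 1) → V} (hp : IsWalk E p) (j : Fin (l + 1)) :
    lay (p j) = j := by
  have h := (hE _ (hp ⟨l - 1, by omega⟩)).2
  simp only at h
  rw [hp.lay_eq_add hE] at h
  have h2 := hp.lay_eq_add hE j
  simp only [Fin.val_succ] at h
  omega

/-! ### Systems of disjoint walks -/

/-- Greedy choice of `m` pairwise compatible elements, each of which rules out at most `D`. -/
theorem pow_le_card_pairwise {β : Type*} [Fintype β] [DecidableEq β] {S : Finset β} {r : β → β → Prop}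
    [DecidableRel r]
    (hr : ∀ p q, r p q → r q p) {D K : ℝ} (hK : 0 ≤ K) (hD0 : 0 ≤ D)
    (hD : ∀ p ∈ S, ((S.filter fun q => r p q).card : ℝ) ≤ D) (m : ℕ) (hm : K + m * D ≤ S.card) :
    K ^ m ≤ (Finset.univ.filter fun x : Fin m → β =>
      (∀ i, x i ∈ S) ∧ ∀ i i', i ≠ i' → ¬ r (x i) (x i')).card := by
  induction m with
  | zero => simp
  | succ m ih =>
    push_cast at hm
    set F := Finset.univ.filter fun x : Fin m → β =>
      (∀ i, x i ∈ S) ∧ ∀ i i', i ≠ i' → ¬ r (x i) (x i') with hF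
    have ih' := ih (by linarith)
    let ext : (Fin m → β) → Finset β := fun x => S.filter fun q => ∀ i, ¬ r (x i) q
    have hext : ∀ x ∈ F, K ≤ (ext x).card := by
      intro x hx
      have hx2 : (∀ i, x i ∈ S) ∧ ∀ i i', i ≠ i' → ¬ r (x i) (x i') := by simpa [hF] using hx
      have h1 : S ⊆ ext x ∪ Finset.univ.biUnion fun i => S.filter fun q => r (x i) q := by
        intro q hq
        by_cases h : ∀ i, ¬ r (x i) q
        · exact Finset.mem_union_left _ (by simp [ext, hq, h])
        · push Not at h
          refine Finset.mem_union_right _ ?_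
          simpa [hq] using h
      have h2 : (S.card : ℝ) ≤ (ext x).card + m * D := by
        calc (S.card : ℝ) ≤ ((ext x).card + ∑ i : Fin m, (S.filter fun q => r (x i) q).card : ℕ) := by
              exact_mod_cast (Finset.card_le_card h1).trans ((Finset.card_union_le _ _).trans
                (Nat.add_le_add_left Finset.card_biUnion_le _))
          _ ≤ (ext x).card + ∑ i : Fin m, D := by
              push_cast
              gcongr with i
              exact hD _ (hx2.1 i)
          _ = _ := by simp
      linarith
    have hcard : (F.sigma ext).card ≤ (Finset.univ.filter fun x : Fin (m + 1) → β =>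
        (∀ i, x i ∈ S) ∧ ∀ i i', i ≠ i' → ¬ r (x i) (x i')).card := by
      refine Finset.card_le_card_of_injOn (fun z => (Fin.cons z.2 z.1 : Fin (m + 1) → β)) ?_ ?_
      · rintro ⟨x, q⟩ hz
        have hz2 : ((∀ i, x i ∈ S) ∧ ∀ i i', i ≠ i' → ¬ r (x i) (x i')) ∧ q ∈ S ∧
            ∀ i, ¬ r (x i) q := by simpa [hF, ext] using hz
        obtain ⟨⟨h1, h2⟩, h3, h4⟩ := hz2
        simp only [Finset.coe_filter, Finset.mem_univ, true_and, Set.mem_ofPred_eq,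
          Fin.forall_fin_succ, Fin.cons_zero, Fin.cons_succ]
        refine ⟨⟨h3, h1⟩, ⟨fun h => (h rfl).elim, fun i _ h => h4 i (hr _ _ h)⟩, fun i =>
          ⟨fun _ => h4 i, fun i' hi => h2 i i' fun h => hi (by rw [h])⟩⟩
      · rintro ⟨x, q⟩ _ ⟨x', q'⟩ _ h
        simp only [Fin.cons_inj] at h
        obtain ⟨rfl, rfl⟩ := h
        rfl
    calc K ^ (m + 1) = K ^ m * K := pow_succ _ _
      _ ≤ F.card * K := by gcongr
      _ = ∑ x ∈ F, K := by rw [Finset.sum_const, nsmul_eq_mul]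
      _ ≤ ∑ x ∈ F, ((ext x).card : ℝ) := Finset.sum_le_sum hext
      _ = ((F.sigma ext).card : ℝ) := by rw [Finset.card_sigma]; push_cast; rfl
      _ ≤ _ := by exact_mod_cast hcard

open Classical in
/-- A nearly `b`-regular layered digraph has about `(N * b ^ l) ^ m` systems of `m` disjoint walks,
as long as these walks use only a small fraction of each layer. -/
theorem pow_le_card_walkSystem [Fintype V] [DecidableEq V] {E : Finset (V × V)} {lay : V → ℕ}
    {l b N m : ℕ} (hE : IsLayered lay l E)
    (hN : ∀ j ≤ l, (Finset.univ.filter fun v => lay v = j).card = N)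
    (hout : ∀ u, (Finset.univ.filter fun v => (u, v) ∈ E).card ≤ b)
    (hin : ∀ v, (Finset.univ.filter fun u => (u, v) ∈ E).card ≤ b)
    {B : ℝ} (hdef : ∀ j < l, ∑ v ∈ Finset.univ.filter (fun v => lay v = j + 1),
      ((b : ℝ) - (Finset.univ.filter fun u => (u, v) ∈ E).card) ≤ b * B)
    (hB : l * B ≤ N / 2) (hm : m * (l + 1) ≤ (N : ℝ) / 4) :
    ((N : ℝ) * b ^ l / 4) ^ m ≤
      (Finset.univ.filter fun x : Fin m → Fin (l + 1) → V => IsWalkSystem E x).card := by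
  set a : V → V → ℝ := fun u v => if (u, v) ∈ E then (1 : ℝ) else 0 with ha
  have ha0 : ∀ u v, 0 ≤ a u v := fun u v => by simp only [ha]; split_ifs <;> norm_num
  have hrow : ∀ u, ∑ v, a u v ≤ b := fun u => by
    simp only [ha]; rw [Finset.sum_boole]; exact_mod_cast hout u
  have hcol : ∀ v, ∑ u, a u v ≤ b := fun v => by
    simp only [ha]; rw [Finset.sum_boole]; exact_mod_cast hin v
  set S := Finset.univ.filter fun p : Fin (l + 1) → V => IsWalk E p with hS
  have hScard : (N : ℝ) * b ^ l / 2 ≤ S.card := by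
    calc (N : ℝ) * b ^ l / 2 ≤ b ^ l * (N - l * B) := by
          have : (0 : ℝ) ≤ (b : ℝ) ^ l := by positivity
          nlinarith
      _ ≤ _ := le_sum_walkWeight_layer hE hN hout hin hdef l 0 (by omega)
      _ ≤ ∑ p : Fin (l + 1) → V, walkWeight a p := by
          refine Finset.sum_le_sum fun p _ => ?_
          split_ifs
          exacts [le_rfl, walkWeight_nonneg ha0 p]
      _ = S.card := by
          rw [hS, ← Finset.sum_boole]
          exact Finset.sum_congr rfl fun p _ => walkWeight_adj E p
  have hconf : ∀ p ∈ S, ((S.filter fun q => ∃ j, p j = q j).card : ℝ) ≤ (l + 1) * b ^ l := by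
    intro p _
    have h1 : (S.filter fun q => ∃ j, p j = q j) ⊆
        Finset.univ.biUnion fun j => S.filter fun q => q j = p j := by
      intro q hq
      rw [Finset.mem_filter] at hq
      obtain ⟨hq, j, hj⟩ := hq
      simp only [Finset.mem_biUnion, Finset.mem_univ, true_and]
      exact ⟨j, Finset.mem_filter.2 ⟨hq, hj.symm⟩⟩
    calc ((S.filter fun q => ∃ j, p j = q j).card : ℝ)
        ≤ ∑ j : Fin (l + 1), ((S.filter fun q => q j = p j).card : ℝ) := by
          exact_mod_cast (Finset.card_le_card h1).trans Finset.card_biUnion_le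
      _ ≤ ∑ j : Fin (l + 1), (b : ℝ) ^ l := by
          refine Finset.sum_le_sum fun j _ => ?_
          refine le_trans (le_of_eq ?_)
            (sum_walkWeight_through_le ha0 b.cast_nonneg hrow hcol l j (p j))
          rw [hS, Finset.filter_filter, ← Finset.sum_boole]
          refine Finset.sum_congr rfl fun q _ => ?_
          rw [walkWeight_adj E q]
          by_cases h1 : IsWalk E q <;> by_cases h2 : q j = p j <;> simp [h1, h2]
      _ = _ := by simp
  have hsys := pow_le_card_pairwise (S := S) (r := fun p q => ∃ j, p j = q j)
    (fun p q ⟨j, hj⟩ => ⟨j, hj.symm⟩) (K := (N : ℝ) * b ^ l / 4)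
    (D := (l + 1) * (b : ℝ) ^ l) (by positivity) (by positivity)
    hconf m (by
      have : (0 : ℝ) ≤ (b : ℝ) ^ l := by positivity
      nlinarith)
  refine hsys.trans (Nat.cast_le.2 (Finset.card_le_card fun x hx => ?_))
  have hx := (Finset.mem_filter.1 hx).2
  exact Finset.mem_filter.2 ⟨Finset.mem_univ _, fun i => by simpa [hS] using hx.1 i,
    fun i i' h j e => hx.2 i i' h ⟨j, e⟩⟩

/-- The edges of a family of vertex sequences. -/
def systemEdges [DecidableEq V] {m l : ℕ} (x : Fin m → Fin (l + 1) → V) : Finset (V × V) :=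
  Finset.univ.image fun ij : Fin m × Fin l => (x ij.1 ij.2.castSucc, x ij.1 ij.2.succ)

theorem IsWalkSystem.injective {E : Finset (V × V)} {lay : V → ℕ} {m l : ℕ} (hl : 0 < l)
    (hE : IsLayered lay l E) {x : Fin m → Fin (l + 1) → V} (hx : IsWalkSystem E x) :
    Function.Injective fun ij : Fin m × Fin l => x ij.1 ij.2.castSucc := by
  rintro ⟨i, j⟩ ⟨i', j'⟩ h
  simp only at h
  have h1 := (hx.1 i).lay_eq hl hE j.castSucc
  have h2 := (hx.1 i').lay_eq hl hE j'.castSucc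
  rw [h, h2] at h1
  have h3 : j' = j := Fin.ext (by simpa using h1)
  subst h3
  by_cases hi : i = i'
  · rw [hi]
  · exact (hx.2 i i' hi _ h).elim

theorem IsWalkSystem.card_systemEdges [DecidableEq V] {E : Finset (V × V)} {lay : V → ℕ} {m l : ℕ}
    (hl : 0 < l) (hE : IsLayered lay l E) {x : Fin m → Fin (l + 1) → V} (hx : IsWalkSystem E x) :
    (systemEdges x).card = m * l := by
  rw [systemEdges, Finset.card_image_of_injective]
  · simp
  · intro a b h
    exact hx.injective hl hE (Prod.ext_iff.1 h).1

/-- The arithmetic-geometric mean inequality, with an upper bound for the sum. -/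
theorem prod_le_div_card_pow {ι : Type*} [Fintype ι] [Nonempty ι] {d : ι → ℝ} {S : ℝ}
    (hd : ∀ i, 0 ≤ d i) (hS : 0 < S) (hsum : ∑ i, d i ≤ S) :
    ∏ i, d i ≤ (S / Fintype.card ι) ^ Fintype.card ι := by
  have hc : (0 : ℝ) < Fintype.card ι := by exact_mod_cast Fintype.card_pos
  set A : ℝ := S / Fintype.card ι with hA
  have hA0 : 0 < A := by positivity
  have h1 : ∏ i, d i / A ≤ 1 := by
    calc ∏ i, d i / A ≤ ∏ i, Real.exp (d i / A - 1) := by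
          refine Finset.prod_le_prod (fun i _ => div_nonneg (hd i) hA0.le) fun i _ => ?_
          linarith [Real.add_one_le_exp (d i / A - 1)]
      _ = Real.exp (∑ i, (d i / A - 1)) := (Real.exp_sum _ _).symm
      _ ≤ Real.exp 0 := by
          apply Real.exp_le_exp.2
          rw [Finset.sum_sub_distrib, ← Finset.sum_div]
          have : (∑ i, d i) / A ≤ Fintype.card ι := by
            rw [div_le_iff₀ hA0, hA, mul_div_cancel₀ _ hc.ne']
            exact hsum
          simpa using this
      _ = 1 := Real.exp_zero
  rw [Finset.prod_div_distrib, Finset.prod_const, div_le_one (by positivity)] at h1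
  exact h1

open Classical in
/-- Few walk systems fit into a set `U` of edges. Let `m` random walkers follow edges of `U`. A
given system inside `U` is their trajectory with probability at least
`(m * l / |U|) ^ (m * l)` by the inequality of arithmetic and geometric means, because the outdegrees of
its distinct vertices sum up to at most `|U|`. -/
theorem card_walkSystem_le [Fintype V] [DecidableEq V] {E U : Finset (V × V)} {lay : V → ℕ}
    {l N m : ℕ} (hl : 0 < l) (hm : 0 < m) (hE : IsLayered lay l E)
    (hN : (Finset.univ.filter fun v => lay v = 0).card = N) :
    ((Finset.univ.filter fun x : Fin m → Fin (l + 1) → V =>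
      IsWalkSystem E x ∧ systemEdges x ⊆ U).card : ℝ) ≤
      (N : ℝ) ^ m * ((U.card : ℝ) / (m * l : ℕ)) ^ (m * l) := by
  let deg : V → ℕ := fun u => (Finset.univ.filter fun v => (u, v) ∈ U).card
  let a : V → V → ℝ := fun u v => if (u, v) ∈ U then (deg u : ℝ)⁻¹ else 0
  have ha0 : ∀ u v, 0 ≤ a u v := fun u v => by simp only [a]; split_ifs <;> positivity
  have hrow : ∀ u, ∑ v, a u v ≤ 1 := by
    intro u
    simp only [a]
    rw [← Finset.sum_filter, Finset.sum_const, nsmul_eq_mul]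
    exact mul_inv_le_one
  have hdegsum : ∑ u, deg u = U.card := by
    rw [Finset.card_eq_sum_card_fiberwise (f := Prod.fst) (t := Finset.univ)
      (fun _ _ => Finset.mem_coe.2 (Finset.mem_univ _))]
    refine Finset.sum_congr rfl fun u _ => ?_
    refine Finset.card_bij' (fun v _ => (u, v)) (fun e _ => e.2) ?_ ?_ ?_ ?_
    · intro v hv; simpa using hv
    · rintro ⟨u', v⟩ hv
      have : (u', v) ∈ U ∧ u' = u := by simpa using hv
      obtain ⟨h1, rfl⟩ := this
      simpa using h1
    · simp
    · rintro ⟨u', v⟩ hv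
      have : (u', v) ∈ U ∧ u' = u := by simpa using hv
      simp [this.2]
  set S := Finset.univ.filter fun x : Fin m → Fin (l + 1) → V =>
      IsWalkSystem E x ∧ systemEdges x ⊆ U with hS
  have htot : ∑ p : Fin (l + 1) → V, (if lay (p 0) = 0 then walkWeight a p else 0) ≤ N := by
    calc _ = ∑ v ∈ Finset.univ.filter (fun v => lay v = 0), ∑ p : Fin (l + 1) → V,
          (if p 0 = v then walkWeight a p else 0) := by
          rw [Finset.sum_comm]
          refine Finset.sum_congr rfl fun p _ => ?_
          rw [Finset.sum_filter, Finset.sum_eq_single (p 0)]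
          · simp
          · intro v _ hv; simp [hv.symm]
          · simp
      _ ≤ ∑ v ∈ Finset.univ.filter (fun v => lay v = 0), (1 : ℝ) ^ l :=
          Finset.sum_le_sum fun v _ => sum_walkWeight_start_le ha0 zero_le_one hrow l v
      _ = N := by simp [hN]
  have hpow : ∑ x : Fin m → Fin (l + 1) → V,
      ∏ i, (if lay (x i 0) = 0 then walkWeight a (x i) else 0) ≤ (N : ℝ) ^ m := by
    rw [← Fintype.sum_pow (fun p : Fin (l + 1) → V =>
      if lay (p 0) = 0 then walkWeight a p else 0) m]
    refine pow_le_pow_left₀ (Finset.sum_nonneg fun p _ => ?_) htot m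
    split_ifs
    exacts [walkWeight_nonneg ha0 p, le_rfl]
  have : Nonempty (Fin m × Fin l) := ⟨(⟨0, hm⟩, ⟨0, hl⟩)⟩
  have hQ : 0 < m * l := Nat.mul_pos hm hl
  have hx : ∀ x ∈ S, 1 ≤ ((U.card : ℝ) / (m * l : ℕ)) ^ (m * l) *
      ∏ i, (if lay (x i 0) = 0 then walkWeight a (x i) else 0) := by
    intro x hx
    obtain ⟨hxE, hxU⟩ : IsWalkSystem E x ∧ systemEdges x ⊆ U := by simpa [hS] using hx
    have hmem : ∀ ij : Fin m × Fin l, (x ij.1 ij.2.castSucc, x ij.1 ij.2.succ) ∈ U := fun ij =>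
      hxU (Finset.mem_image_of_mem _ (Finset.mem_univ ij))
    have hUpos : 0 < U.card := Finset.card_pos.2 ⟨_, hmem (Classical.arbitrary _)⟩
    have hdpos : ∀ ij : Fin m × Fin l, (0 : ℝ) < deg (x ij.1 ij.2.castSucc) := fun ij => by
      have : 0 < deg (x ij.1 ij.2.castSucc) :=
        Finset.card_pos.2 ⟨x ij.1 ij.2.succ, by simpa using hmem ij⟩
      exact_mod_cast this
    have h1 : ∏ i, (if lay (x i 0) = 0 then walkWeight a (x i) else 0) =
        (∏ ij : Fin m × Fin l, (deg (x ij.1 ij.2.castSucc) : ℝ))⁻¹ := by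
      rw [← Finset.prod_inv_distrib, Fintype.prod_prod_type]
      refine Finset.prod_congr rfl fun i _ => ?_
      have h0 : lay (x i 0) = 0 := (hxE.1 i).lay_eq hl hE 0
      rw [if_pos h0, walkWeight]
      refine Finset.prod_congr rfl fun j _ => ?_
      simp only [a]
      rw [if_pos (hmem (i, j))]
    have h2 : ∑ ij : Fin m × Fin l, (deg (x ij.1 ij.2.castSucc) : ℝ) ≤ U.card := by
      rw [← hdegsum]
      push_cast
      rw [← Finset.sum_image (s := Finset.univ)
        (g := fun ij : Fin m × Fin l => x ij.1 ij.2.castSucc) (f := fun v => (deg v : ℝ))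
        (fun p _ q _ h => hxE.injective hl hE h)]
      exact Finset.sum_le_sum_of_subset_of_nonneg (Finset.subset_univ _)
        fun _ _ _ => by positivity
    have h3 := prod_le_div_card_pow (fun ij => (hdpos ij).le) (by exact_mod_cast hUpos) h2
    rw [h1, ← div_eq_mul_inv, one_le_div (Finset.prod_pos fun ij _ => hdpos ij)]
    simpa using h3
  calc (S.card : ℝ) = ∑ x ∈ S, (1 : ℝ) := by simp
    _ ≤ ∑ x ∈ S, ((U.card : ℝ) / (m * l : ℕ)) ^ (m * l) *
        ∏ i, (if lay (x i 0) = 0 then walkWeight a (x i) else 0) := Finset.sum_le_sum hx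
    _ ≤ ∑ x : Fin m → Fin (l + 1) → V, ((U.card : ℝ) / (m * l : ℕ)) ^ (m * l) *
        ∏ i, (if lay (x i 0) = 0 then walkWeight a (x i) else 0) := by
        refine Finset.sum_le_sum_of_subset_of_nonneg (Finset.subset_univ _) fun x _ _ => ?_
        refine mul_nonneg (by positivity) (Finset.prod_nonneg fun i _ => ?_)
        split_ifs
        exacts [walkWeight_nonneg ha0 _, le_rfl]
    _ = ((U.card : ℝ) / (m * l : ℕ)) ^ (m * l) * ∑ x : Fin m → Fin (l + 1) → V,
        ∏ i, (if lay (x i 0) = 0 then walkWeight a (x i) else 0) := by rw [Finset.mul_sum]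
    _ ≤ ((U.card : ℝ) / (m * l : ℕ)) ^ (m * l) * (N : ℝ) ^ m := by gcongr
    _ = _ := mul_comm _ _

end Walks

/-! ### Nearly regular layered graphs without short cycles -/

/-- The undirected graph underlying a digraph, which is given by its finite set of edges. -/
def underlyingGraph {V : Type*} (E : Finset (V × V)) : SimpleGraph V :=
  SimpleGraph.fromRel fun u v => (u, v) ∈ E

/-- The ends of each edge have distance at least `k` once the edge is removed. For layered digraphs
this says that the underlying graph has girth at least `k + 1`. -/
def HasLongDetours {V : Type*} [DecidableEq V] (k : ℕ) (E : Finset (V × V)) : Prop :=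
  ∀ e ∈ E, (k : ℕ∞) ≤ (underlyingGraph (E.erase e)).edist e.1 e.2

section Graphs

variable {V : Type*}

theorem underlyingGraph_adj {E : Finset (V × V)} {u v : V} :
    (underlyingGraph E).Adj u v ↔ u ≠ v ∧ ((u, v) ∈ E ∨ (v, u) ∈ E) := Iff.rfl

theorem underlyingGraph_mono {E F : Finset (V × V)} (h : E ⊆ F) :
    underlyingGraph E ≤ underlyingGraph F := by
  intro u v
  rw [underlyingGraph_adj, underlyingGraph_adj]
  exact fun ⟨h1, h2⟩ => ⟨h1, h2.imp (@h _) (@h _)⟩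

theorem edist_le_one_of_mem {E : Finset (V × V)} {u v : V} (h : (u, v) ∈ E ∨ (v, u) ∈ E) :
    (underlyingGraph E).edist u v ≤ 1 := by
  by_cases huv : u = v
  · simp [huv]
  · exact (SimpleGraph.edist_eq_one_iff_adj.2 (underlyingGraph_adj.2 ⟨huv, h⟩)).le

/-- A walk in a graph with an additional edge `uv` either can avoid this edge or gives rise to walks
from its ends to the ends of `uv`. -/
theorem edist_le_length_of_insert [DecidableEq V] {F : Finset (V × V)} {u v x y : V}
    (p : (underlyingGraph (insert (u, v) F)).Walk x y) :
    (underlyingGraph F).edist x y ≤ p.length ∨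
    (underlyingGraph F).edist x u + 1 + (underlyingGraph F).edist v y ≤ p.length ∨
    (underlyingGraph F).edist x v + 1 + (underlyingGraph F).edist u y ≤ p.length := by
  induction p with
  | nil => left; simp
  | @cons x x' y h p ih =>
    set G := underlyingGraph F with hG
    rw [SimpleGraph.Walk.length_cons]
    push_cast
    have hF : ((x, x') ∈ F ∨ (x', x) ∈ F) → ∀ z, G.edist x z ≤ 1 + G.edist x' z := fun h z =>
      SimpleGraph.edist_triangle.trans (add_le_add_left (edist_le_one_of_mem h) _)
    have hstep : ((x, x') ∈ F ∨ (x', x) ∈ F) →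
        G.edist x y ≤ p.length + 1 ∨ G.edist x u + 1 + G.edist v y ≤ p.length + 1 ∨
        G.edist x v + 1 + G.edist u y ≤ p.length + 1 := by
      intro h
      rcases ih with h1 | h1 | h1
      · left
        rw [add_comm (p.length : ℕ∞)]
        exact (hF h y).trans (by gcongr)
      · right; left
        rw [add_comm (p.length : ℕ∞)]
        calc _ ≤ 1 + G.edist x' u + 1 + G.edist v y := by gcongr; exact hF h u
          _ = 1 + (G.edist x' u + 1 + G.edist v y) := by simp only [add_assoc]
          _ ≤ _ := by gcongr
      · right; right
        rw [add_comm (p.length : ℕ∞)]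
        calc _ ≤ 1 + G.edist x' v + 1 + G.edist u y := by gcongr; exact hF h v
          _ = 1 + (G.edist x' v + 1 + G.edist u y) := by simp only [add_assoc]
          _ ≤ _ := by gcongr
    have hle : ∀ a b : ℕ∞, a ≤ b + 1 + a := fun a b => le_add_self
    rcases (underlyingGraph_adj.1 h).2 with h | h <;> rcases Finset.mem_insert.1 h with h | h
    · obtain ⟨rfl, rfl⟩ := Prod.ext_iff.1 h
      dsimp only at ih ⊢
      rcases ih with h1 | h1 | h1
      · right; left
        rw [SimpleGraph.edist_self, zero_add, add_comm]
        gcongr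
      · right; left
        rw [SimpleGraph.edist_self, zero_add, add_comm]
        gcongr
        exact (hle _ _).trans h1
      · left
        exact ((hle _ _).trans h1).trans le_self_add
    · exact hstep (Or.inl h)
    · obtain ⟨rfl, rfl⟩ := Prod.ext_iff.1 h
      dsimp only at ih ⊢
      rcases ih with h1 | h1 | h1
      · right; right
        rw [SimpleGraph.edist_self, zero_add, add_comm]
        gcongr
      · left
        exact ((hle _ _).trans h1).trans le_self_add
      · right; right
        rw [SimpleGraph.edist_self, zero_add, add_comm]
        gcongr
        exact (hle _ _).trans h1
    · exact hstep (Or.inr h)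

/-- Joining two vertices of distance at least `k` creates no short cycle. -/
theorem HasLongDetours.insert [DecidableEq V] {k : ℕ} {E : Finset (V × V)} (hE : HasLongDetours k E)
    {u v : V} (huv : (u, v) ∉ E) (hk : (k : ℕ∞) ≤ (underlyingGraph E).edist u v) :
    HasLongDetours k (insert (u, v) E) := by
  intro e he
  rcases Finset.mem_insert.1 he with rfl | he
  · rwa [Finset.erase_insert huv]
  · obtain ⟨x, y⟩ := e
    have hne : (u, v) ≠ (x, y) := fun h => huv (h ▸ he)
    rw [Finset.erase_insert_of_ne hne]
    by_contra! hlt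
    obtain ⟨p, hp⟩ := SimpleGraph.exists_walk_of_edist_ne_top (ne_top_of_lt hlt)
    rw [← hp] at hlt
    have hmono := underlyingGraph_mono (Finset.erase_subset (x, y) E)
    have hxy := edist_le_one_of_mem (Or.inl he)
    rcases edist_le_length_of_insert p with h | h | h
    · exact absurd ((hE _ he).trans h) (not_le.2 hlt)
    · refine absurd (hk.trans (le_trans ?_ h)) (not_le.2 hlt)
      calc _ ≤ (underlyingGraph E).edist u x + ((underlyingGraph E).edist x y +
            (underlyingGraph E).edist y v) := SimpleGraph.edist_triangle.trans
              (add_le_add_right SimpleGraph.edist_triangle _)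
        _ ≤ (underlyingGraph (E.erase (x, y))).edist x u + (1 +
            (underlyingGraph (E.erase (x, y))).edist v y) := by
            rw [SimpleGraph.edist_comm (u := u), SimpleGraph.edist_comm (u := y)]
            gcongr
        _ = _ := (add_assoc _ _ _).symm
    · refine absurd (hk.trans (le_trans ?_ h)) (not_le.2 hlt)
      calc _ ≤ ((underlyingGraph E).edist u y + (underlyingGraph E).edist y x) +
            (underlyingGraph E).edist x v := SimpleGraph.edist_triangle.trans
              (add_le_add_left SimpleGraph.edist_triangle _)
        _ ≤ ((underlyingGraph (E.erase (x, y))).edist u y + 1) +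
            (underlyingGraph (E.erase (x, y))).edist x v := by
            rw [SimpleGraph.edist_comm (u := y) (v := x)]
            gcongr
        _ = _ := by rw [add_comm, add_comm _ (1 : ℕ∞), add_assoc]

open Classical in
theorem card_ball_le [Fintype V] [DecidableEq V] {G : SimpleGraph V} {Δ : ℕ}
    (hG : ∀ u, (Finset.univ.filter fun v => G.Adj u v).card ≤ Δ) (i : ℕ) (u : V) :
    (Finset.univ.filter fun v => G.edist u v ≤ i).card ≤ (Δ + 1) ^ i := by
  induction i generalizing u with
  | zero =>
    have : (Finset.univ.filter fun v => G.edist u v ≤ (0 : ℕ)) = {u} := by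
      ext v
      simpa using eq_comm
    rw [this]; simp
  | succ i ih =>
    have hsub : (Finset.univ.filter fun v => G.edist u v ≤ (i + 1 : ℕ)) ⊆
        (insert u (Finset.univ.filter fun v => G.Adj u v)).biUnion
          fun w => Finset.univ.filter fun v => G.edist w v ≤ i := by
      intro v hv
      have hv : G.edist u v ≤ (i + 1 : ℕ) := by simpa using hv
      simp only [Finset.mem_biUnion, Finset.mem_insert, Finset.mem_filter, Finset.mem_univ, true_and]
      obtain ⟨p, hp⟩ := SimpleGraph.exists_walk_of_edist_ne_top
        (ne_top_of_le_ne_top (ENat.natCast_ne_top _) hv)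
      rw [← hp] at hv
      cases p with
      | nil => exact ⟨u, Or.inl rfl, by simp⟩
      | @cons _ w _ h p =>
        refine ⟨w, Or.inr h, (SimpleGraph.edist_le p).trans ?_⟩
        rw [SimpleGraph.Walk.length_cons] at hv
        have : p.length + 1 ≤ i + 1 := by exact_mod_cast hv
        exact_mod_cast Nat.le_of_succ_le_succ this
    calc _ ≤ _ := Finset.card_le_card hsub
      _ ≤ ∑ w ∈ insert u (Finset.univ.filter fun v => G.Adj u v), (Δ + 1) ^ i :=
          Finset.card_biUnion_le.trans (Finset.sum_le_sum fun w _ => ih w)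
      _ ≤ (Δ + 1) * (Δ + 1) ^ i := by
          rw [Finset.sum_const, smul_eq_mul]
          gcongr
          exact (Finset.card_insert_le _ _).trans (Nat.succ_le_succ (hG u))
      _ = _ := by ring

open Classical in
theorem card_adj_underlyingGraph_le [Fintype V] [DecidableEq V] {E : Finset (V × V)} {b : ℕ}
    (hout : ∀ u, (Finset.univ.filter fun v => (u, v) ∈ E).card ≤ b)
    (hin : ∀ v, (Finset.univ.filter fun u => (u, v) ∈ E).card ≤ b) (u : V) :
    (Finset.univ.filter fun v => (underlyingGraph E).Adj u v).card ≤ 2 * b := by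
  have : (Finset.univ.filter fun v => (underlyingGraph E).Adj u v) ⊆
      (Finset.univ.filter fun v => (u, v) ∈ E) ∪ (Finset.univ.filter fun v => (v, u) ∈ E) := by
    intro v hv
    have := (underlyingGraph_adj.1 (Finset.mem_filter.1 hv).2).2
    simpa using this
  calc _ ≤ _ := Finset.card_le_card this
    _ ≤ _ := Finset.card_union_le _ _
    _ ≤ b + b := add_le_add (hout u) (hin u)
    _ = _ := by ring

open Classical in
/-- A layered graph that is maximal subject to bounds for the degrees and the girth is nearly regular:
a vertex of a layer with too small an outdegree is close to all vertices of the next layer with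
too small an indegree, for it could be joined to them otherwise. -/
theorem exists_layered_hasLongDetours [Fintype V] [DecidableEq V] (lay : V → ℕ) {l b N k : ℕ} (hk : 1 ≤ k)
    (hN : ∀ j ≤ l, (Finset.univ.filter fun v => lay v = j).card = N) :
    ∃ E : Finset (V × V), IsLayered lay l E ∧ HasLongDetours k E ∧
      (∀ u, (Finset.univ.filter fun v => (u, v) ∈ E).card ≤ b) ∧
      (∀ v, (Finset.univ.filter fun u => (u, v) ∈ E).card ≤ b) ∧
      ∀ j < l, ∑ v ∈ Finset.univ.filter (fun v => lay v = j + 1),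
        ((b : ℝ) - (Finset.univ.filter fun u => (u, v) ∈ E).card) ≤ b * (2 * b + 1) ^ k := by
  let S : Finset (Finset (V × V)) := Finset.univ.filter fun E =>
    IsLayered lay l E ∧ HasLongDetours k E ∧
      (∀ u, (Finset.univ.filter fun v => (u, v) ∈ E).card ≤ b) ∧
      (∀ v, (Finset.univ.filter fun u => (u, v) ∈ E).card ≤ b)
  have hS : S.Nonempty := ⟨∅, by simp [S, IsLayered, HasLongDetours]⟩
  obtain ⟨E, hES, hmax⟩ := S.exists_max_image Finset.card hS
  obtain ⟨hlay, hdet, hout, hin⟩ : IsLayered lay l E ∧ HasLongDetours k E ∧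
      (∀ u, (Finset.univ.filter fun v => (u, v) ∈ E).card ≤ b) ∧
      (∀ v, (Finset.univ.filter fun u => (u, v) ∈ E).card ≤ b) := by
    simpa only [S, Finset.mem_filter, Finset.mem_univ, true_and] using hES
  refine ⟨E, hlay, hdet, hout, hin, fun j hj => ?_⟩
  have hdeg := card_adj_underlyingGraph_le hout hin
  by_cases hu : ∃ u, lay u = j ∧ (Finset.univ.filter fun v => (u, v) ∈ E).card < b
  · obtain ⟨u, huj, hub⟩ := hu
    have hclose : ∀ v, lay v = j + 1 → (Finset.univ.filter fun u => (u, v) ∈ E).card < b →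
        (underlyingGraph E).edist u v ≤ k := by
      intro v hvj hvb
      by_contra! hlt
      have huv : (u, v) ∉ E := fun h => by
        have h1 := hlt.trans_le (edist_le_one_of_mem (Or.inl h))
        have h2 : k < 1 := by exact_mod_cast h1
        omega
      have hmem : insert (u, v) E ∈ S := by
        simp only [S, Finset.mem_filter, Finset.mem_univ, true_and]
        refine ⟨?_, hdet.insert huv hlt.le, fun u' => ?_, fun v' => ?_⟩
        · intro e he
          rcases Finset.mem_insert.1 he with rfl | he
          · simp only; omega
          · exact hlay e he
        · by_cases h : u' = u
          · subst h
            refine le_trans (Finset.card_le_card (t := insert v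
              (Finset.univ.filter fun v => (u', v) ∈ E)) ?_) ((Finset.card_insert_le _ _).trans hub)
            intro w hw
            simpa using hw
          · refine le_trans (Finset.card_le_card ?_) (hout u')
            intro w hw
            simpa [h] using hw
        · by_cases h : v' = v
          · subst h
            refine le_trans (Finset.card_le_card (t := insert u
              (Finset.univ.filter fun u => (u, v') ∈ E)) ?_) ((Finset.card_insert_le _ _).trans hvb)
            intro w hw
            simpa using hw
          · refine le_trans (Finset.card_le_card ?_) (hin v')
            intro w hw
            simpa [h] using hw
      have := hmax _ hmem
      rw [Finset.card_insert_of_notMem huv] at this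
      omega
    calc _ ≤ ∑ v ∈ Finset.univ.filter (fun v => lay v = j + 1),
          (if (underlyingGraph E).edist u v ≤ k then (b : ℝ) else 0) := by
          refine Finset.sum_le_sum fun v hv => ?_
          have hv : lay v = j + 1 := by simpa using hv
          by_cases hvb : (Finset.univ.filter fun u => (u, v) ∈ E).card < b
          · rw [if_pos (hclose v hv hvb), sub_le_self_iff]
            positivity
          · have : (Finset.univ.filter fun u => (u, v) ∈ E).card = b :=
              le_antisymm (hin v) (not_lt.1 hvb)
            rw [this, sub_self]
            split_ifs <;> positivity
      _ ≤ ∑ v, (if (underlyingGraph E).edist u v ≤ k then (b : ℝ) else 0) :=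
          Finset.sum_le_sum_of_subset_of_nonneg (Finset.filter_subset _ _) fun v _ _ => by
            split_ifs <;> positivity
      _ = b * (Finset.univ.filter fun v => (underlyingGraph E).edist u v ≤ k).card := by
          rw [← Finset.sum_filter, Finset.sum_const, nsmul_eq_mul, mul_comm]
      _ ≤ b * (2 * b + 1) ^ k := by
          gcongr
          exact_mod_cast card_ball_le hdeg k u
  · push Not at hu
    have h1 : ∑ u ∈ Finset.univ.filter (fun u => lay u = j), (b : ℝ) ≤
        ∑ v ∈ Finset.univ.filter (fun v => lay v = j + 1),
          ((Finset.univ.filter fun u => (u, v) ∈ E).card : ℝ) := by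
      calc ∑ u ∈ Finset.univ.filter (fun u => lay u = j), (b : ℝ)
          ≤ ∑ u ∈ Finset.univ.filter (fun u => lay u = j),
            ∑ v ∈ Finset.univ.filter (fun v => lay v = j + 1),
              (if (u, v) ∈ E then (1 : ℝ) else 0) := by
            refine Finset.sum_le_sum fun u hu' => ?_
            have hu' : lay u = j := by simpa using hu'
            have h2 := hu u hu'
            rw [Finset.sum_boole, Finset.filter_filter]
            norm_cast
            refine h2.trans (Finset.card_le_card fun v hv => ?_)
            have hv : (u, v) ∈ E := by simpa using hv
            have := (hlay _ hv).1
            simp only at this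
            simp [hv, this, hu']
        _ = ∑ v ∈ Finset.univ.filter (fun v => lay v = j + 1),
            ∑ u ∈ Finset.univ.filter (fun u => lay u = j),
              (if (u, v) ∈ E then (1 : ℝ) else 0) := Finset.sum_comm
        _ ≤ _ := by
            refine Finset.sum_le_sum fun v _ => ?_
            rw [← Finset.sum_boole]
            exact Finset.sum_le_sum_of_subset_of_nonneg (Finset.filter_subset _ _) fun u _ _ => by
              split_ifs <;> norm_num
    rw [Finset.sum_const, hN j hj.le] at h1
    rw [Finset.sum_sub_distrib, Finset.sum_const, hN (j + 1) hj]
    have : (0 : ℝ) ≤ b * (2 * b + 1) ^ k := by positivity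
    linarith

/-! ### Distances in subgraphs -/

theorem edist_le_of_forall_mem {F : Finset (V × V)} {l : ℕ} {p : Fin (l + 1) → V} (i j : ℕ) (hij : i ≤ j)
    (hj : j ≤ l) (hF : ∀ r : Fin l, i ≤ r → (r : ℕ) < j → (p r.castSucc, p r.succ) ∈ F) :
    (underlyingGraph F).edist (p ⟨i, by omega⟩) (p ⟨j, by omega⟩) ≤ (j - i : ℕ) := by
  induction j, hij using Nat.le_induction with
  | base => simp
  | succ j hij ih =>
    have h1 := ih (by omega) fun r h1 h2 => hF r h1 (by omega)
    have h2 := edist_le_one_of_mem (Or.inl (hF ⟨j, by omega⟩ hij (by simp)))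
    refine SimpleGraph.edist_triangle.trans ((add_le_add h1 h2).trans ?_)
    have : j + 1 - i = (j - i) + 1 := by omega
    rw [this]
    push_cast
    exact le_rfl

/-- If a walk in a layered graph without short cycles loses an edge, then its ends are far apart. -/
theorem IsWalk.le_edist_of_notMem [DecidableEq V] {E y : Finset (V × V)} {lay : V → ℕ} {l d : ℕ}
    (hE : IsLayered lay l E) (hdet : HasLongDetours (d + l) E) {p : Fin (l + 1) → V}
    (hp : IsWalk E p) (hy : y ⊆ E) {j : Fin l} (hj : (p j.castSucc, p j.succ) ∉ y) :
    (d : ℕ∞) ≤ (underlyingGraph y).edist (p 0) (p (Fin.last l)) := by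
  set e := (p j.castSucc, p j.succ) with he
  have hl : 0 < l := j.pos
  set F := E.erase e with hF
  have hmem : ∀ r : Fin l, r ≠ j → (p r.castSucc, p r.succ) ∈ F := by
    intro r hr
    refine Finset.mem_erase.2 ⟨fun h => hr ?_, hp r⟩
    have h1 := (Prod.ext_iff.1 h).1
    simp only [he] at h1
    have h2 := hp.lay_eq hl hE r.castSucc
    rw [h1, hp.lay_eq hl hE] at h2
    exact Fin.ext (by simpa using h2.symm)
  have h1 := edist_le_of_forall_mem (F := F) (p := p) 0 j (Nat.zero_le _) j.2.le fun r _ hr =>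
    hmem r fun h => by rw [h] at hr; omega
  have h2 := edist_le_of_forall_mem (F := F) (p := p) (j + 1) l j.2 le_rfl fun r hr _ =>
    hmem r fun h => by rw [h] at hr; omega
  have h3 : (underlyingGraph F).edist (p 0) (p (Fin.last l)) ≤
      (underlyingGraph y).edist (p 0) (p (Fin.last l)) := by
    refine SimpleGraph.edist_anti (underlyingGraph_mono fun a ha => ?_)
    exact Finset.mem_erase.2 ⟨fun h => hj (h ▸ ha), hy ha⟩
  have h4 := hdet e (hp j)
  have h5 : (underlyingGraph F).edist (p j.castSucc) (p j.succ) ≤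
      (underlyingGraph F).edist (p j.castSucc) (p 0) +
        ((underlyingGraph F).edist (p 0) (p (Fin.last l)) +
          (underlyingGraph F).edist (p (Fin.last l)) (p j.succ)) :=
    SimpleGraph.edist_triangle.trans (add_le_add_right SimpleGraph.edist_triangle _)
  have h1' : (underlyingGraph F).edist (p j.castSucc) (p 0) ≤ (j : ℕ) := by
    rw [SimpleGraph.edist_comm]; exact h1
  have h2' : (underlyingGraph F).edist (p (Fin.last l)) (p j.succ) ≤ (l - (j + 1) : ℕ) := by
    rw [SimpleGraph.edist_comm]; exact h2
  have h6 := h4.trans (h5.trans (add_le_add h1' (add_le_add h3 h2')))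
  by_cases htop : (underlyingGraph y).edist (p 0) (p (Fin.last l)) = ⊤
  · rw [htop]; exact le_top
  · obtain ⟨c, hc⟩ := ENat.ne_top_iff_exists.1 htop
    rw [← hc] at h6 ⊢
    have h7 : d + l ≤ j + (c + (l - (j + 1))) := by exact_mod_cast h6
    have : d ≤ c := by omega
    exact_mod_cast this

end Graphs

/-! ### From distance oracles to walk systems -/

theorem approxDistanceOracle_eq_some_true {n : ℕ} {α : ℝ} {𝒢 : Set (SimpleGraph (Fin n))}
    {u v : Fin n} {d : ℕ+} {G : 𝒢} (h : G.1.edist u v ≤ ((d : ℕ) : ℕ∞)) :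
    approxDistanceOracle α 𝒢 (u, v, d) G = some true := if_pos h

theorem approxDistanceOracle_eq_some_false {n : ℕ} {α : ℝ} (hα : 1 < α)
    {𝒢 : Set (SimpleGraph (Fin n))} {u v : Fin n} {d : ℕ+} {G : 𝒢}
    (h : ((⌈α * (d : ℕ)⌉₊ : ℕ) : ℕ∞) ≤ G.1.edist u v) :
    approxDistanceOracle α 𝒢 (u, v, d) G = some false := by
  have hd : (0 : ℝ) < (d : ℕ) := by exact_mod_cast d.pos
  have h1 : (d : ℕ) < ⌈α * (d : ℕ)⌉₊ := by
    rw [Nat.lt_ceil]; nlinarith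
  have h2 : ¬ G.1.edist u v ≤ ((d : ℕ) : ℕ∞) := by
    rw [not_le]
    exact lt_of_lt_of_le (by exact_mod_cast h1) h
  have h3 : ENNReal.ofReal (α * ((d : ℕ) : ℝ)) ≤ (G.1.edist u v : ENNReal) := by
    calc ENNReal.ofReal (α * ((d : ℕ) : ℝ)) ≤ ENNReal.ofReal (⌈α * (d : ℕ)⌉₊ : ℝ) :=
          ENNReal.ofReal_le_ofReal (Nat.le_ceil _)
      _ = ((⌈α * (d : ℕ)⌉₊ : ℕ∞) : ENNReal) := by
          rw [ENNReal.ofReal_natCast, ENat.toENNReal_coe]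
      _ ≤ _ := ENat.toENNReal_le.2 h
  exact (if_neg h2).trans (if_pos h3)

theorem HasCertificates.mono_graphs {n s w t : ℕ} {α : ℝ} {𝒢 ℋ : Set (SimpleGraph (Fin n))}
    (h : HasCertificates (approxDistanceOracle α 𝒢) s w t) (hsub : ℋ ⊆ 𝒢) :
    HasCertificates (approxDistanceOracle α ℋ) s w t := by
  obtain ⟨T, hT⟩ := h
  refine ⟨fun G => T ⟨G.1, hsub G.2⟩, fun q G hG => ?_⟩
  obtain ⟨P, hP, h⟩ := hT q ⟨G.1, hsub G.2⟩ hG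
  exact ⟨P, hP, fun G' hG' => h ⟨G'.1, hsub G'.2⟩ hG'⟩

theorem card_filter_div_eq {n N l j : ℕ} (hN : 0 < N) (hn : (l + 1) * N ≤ n) (hj : j ≤ l) :
    (Finset.univ.filter fun v : Fin n => (v : ℕ) / N = j).card = N := by
  have h : (Finset.univ.filter fun v : Fin n => (v : ℕ) / N = j).map Fin.valEmbedding =
      Finset.Ico (j * N) ((j + 1) * N) := by
    have hle : (j + 1) * N ≤ n := (Nat.mul_le_mul_right N (by omega)).trans hn
    ext a
    simp only [Finset.mem_map, Finset.mem_filter, Finset.mem_univ, true_and, Fin.valEmbedding_apply,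
      Finset.mem_Ico, ← Nat.le_div_iff_mul_le hN, ← Nat.div_lt_iff_lt_mul hN]
    constructor
    · rintro ⟨v, hv, rfl⟩
      omega
    · rintro ⟨h1, h2⟩
      exact ⟨⟨a, ((Nat.div_lt_iff_lt_mul hN).1 h2).trans_le hle⟩, by simp only; omega, rfl⟩
  rw [← Finset.card_map, h, Nat.card_Ico, ← Nat.sub_mul]
  simp

theorem underlyingGraph_mem_boundedDegreeGraphs {n b : ℕ} {Δ : ℝ} {E : Finset (Fin n × Fin n)}
    (hout : ∀ u, (Finset.univ.filter fun v => (u, v) ∈ E).card ≤ b)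
    (hin : ∀ v, (Finset.univ.filter fun u => (u, v) ∈ E).card ≤ b) (hb : 2 * b ≤ Δ)
    {y : Finset (Fin n × Fin n)} (hy : y ⊆ E) : underlyingGraph y ∈ boundedDegreeGraphs n Δ := by
  classical
  intro v
  refine le_trans ?_ hb
  have h : (underlyingGraph y).neighborSet v ⊆
      ↑(Finset.univ.filter fun u => (underlyingGraph E).Adj v u) := by
    intro u hu
    have : (underlyingGraph y).Adj v u := hu
    simpa using underlyingGraph_mono hy this
  have h2 := Set.ncard_le_ncard h (Finset.finite_toSet _)
  rw [Set.ncard_coe_finset] at h2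
  exact_mod_cast h2.trans (card_adj_underlyingGraph_le hout hin v)

open Classical in
/-- A pair of a walk system and a subgraph containing it is certified by the union of the
certificates for the queries about the ends of its walks: if a walk of the system lost an edge in
another subgraph, its ends would be far apart there. -/
theorem exists_certificate_walkSystem {n s w t m l b : ℕ} {α Δ : ℝ} (hα : 1 < α) (hl : 0 < l)
    {lay : Fin n → ℕ} {E : Finset (Fin n × Fin n)} (hE : IsLayered lay l E)
    (hdet : HasLongDetours (⌈α * l⌉₊ + l) E)
    (hout : ∀ u, (Finset.univ.filter fun v => (u, v) ∈ E).card ≤ b)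
    (hin : ∀ v, (Finset.univ.filter fun u => (u, v) ∈ E).card ≤ b) (hb : 2 * b ≤ Δ)
    (hcert : HasCertificates (approxDistanceOracle α (boundedDegreeGraphs n Δ)) s w t) :
    ∃ T : Finset (Fin n × Fin n) → Fin s → (Fin w → Bool),
      ∀ x : Fin m → Fin (l + 1) → Fin n, IsWalkSystem E x → ∀ y ⊆ E, systemEdges x ⊆ y →
        ∃ P : Finset (Fin s), P.card ≤ min (t * m) s ∧
          ∀ y' ⊆ E, (∀ i ∈ P, T y' i = T y i) → systemEdges x ⊆ y' := by
  have hmem : ∀ y ⊆ E, underlyingGraph y ∈ boundedDegreeGraphs n Δ := fun y hy =>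
    underlyingGraph_mem_boundedDegreeGraphs hout hin hb hy
  obtain ⟨T, hT⟩ := hcert
  refine ⟨fun y => if h : underlyingGraph y ∈ boundedDegreeGraphs n Δ then T ⟨_, h⟩
    else fun _ _ => false, fun x hx y hy hxy => ?_⟩
  let d : ℕ+ := ⟨l, hl⟩
  have htrue : ∀ i, approxDistanceOracle α (boundedDegreeGraphs n Δ) (x i 0, x i (Fin.last l), d)
      ⟨_, hmem y hy⟩ = some true := fun i =>
    approxDistanceOracle_eq_some_true
      (edist_le_of_forall_mem (F := y) (p := x i) 0 l (Nat.zero_le _) le_rfl fun r _ _ =>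
        hxy (Finset.mem_image_of_mem _ (Finset.mem_univ (i, r))))
  have hP := fun i => hT (x i 0, x i (Fin.last l), d) ⟨_, hmem y hy⟩ (by rw [htrue i]; simp)
  choose P hPcard hP using hP
  refine ⟨Finset.univ.biUnion P, le_min ?_ ?_, fun y' hy' hagree => ?_⟩
  · refine Finset.card_biUnion_le.trans ?_
    simp [hPcard, mul_comm]
  · simpa using Finset.card_le_univ (Finset.univ.biUnion P)
  · intro e he
    obtain ⟨⟨i, j⟩, -, rfl⟩ := Finset.mem_image.1 he
    by_contra hj
    have hfalse : approxDistanceOracle α (boundedDegreeGraphs n Δ)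
        (x i 0, x i (Fin.last l), d) ⟨_, hmem y' hy'⟩ = some false :=
      approxDistanceOracle_eq_some_false hα ((hx.1 i).le_edist_of_notMem hE hdet hy' hj)
    have h := hP i ⟨_, hmem y' hy'⟩ (by rw [hfalse]; simp) fun c hc => by
      have := hagree c (Finset.mem_biUnion.2 ⟨i, Finset.mem_univ i, hc⟩)
      simpa only [dif_pos (hmem y hy), dif_pos (hmem y' hy')] using this
    rw [hfalse, htrue i] at h
    simp at h

/-- The lower bound for the number of possible positions of certificates, in terms of the degree
`b`, the distance `l` and the number `m` of simultaneous queries. -/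
theorem pow_le_card_positions {n s w t m l b N : ℕ} {α Δ : ℝ} (hα : 1 < α) (hl : 0 < l)
    (hm : 0 < m) (hn : (l + 1) * N ≤ n) (hb : 2 * b ≤ Δ)
    (hN : l * (2 * b + 1 : ℝ) ^ (⌈α * l⌉₊ + l) ≤ N / 2) (hmN : m * (l + 1) ≤ (N : ℝ) / 4)
    (hcert : HasCertificates (approxDistanceOracle α (boundedDegreeGraphs n Δ)) s w t) :
    (b : ℝ) ^ (m * l) ≤
      (Finset.univ.filter fun P : Finset (Fin s) => P.card ≤ min (t * m) s).card *
        (16 * (w * min (t * m) s / (m * l) + 2)) ^ (m * l) := by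
  classical
  have hm' : (1 : ℝ) ≤ m := by exact_mod_cast hm
  have hN0 : (0 : ℝ) < N := by
    have : (0 : ℝ) ≤ l := l.cast_nonneg
    nlinarith
  have hN0' : 0 < N := by exact_mod_cast hN0
  have hlayer := fun j hj => card_filter_div_eq (j := j) hN0' hn hj
  obtain ⟨E, hE, hdet, hout, hin, hdef⟩ := exists_layered_hasLongDetours (b := b)
    (k := ⌈α * l⌉₊ + l) (fun v : Fin n => (v : ℕ) / N) (by omega) hlayer
  obtain ⟨T, hT⟩ := exists_certificate_walkSystem (m := m) hα hl hE hdet hout hin hb hcert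
  have hmany := pow_le_card_walkSystem (m := m) hE hlayer hout hin hdef hN hmN
  have hQ : 0 < m * l := Nat.mul_pos hm hl
  have hQ' : (0 : ℝ) < (m * l : ℕ) := by exact_mod_cast hQ
  set k := min (t * m) s with hk
  set C := (Finset.univ.filter fun P : Finset (Fin s) => P.card ≤ k).card with hC
  have hfew := card_le_of_certificates
    (ι := {x : Fin m → Fin (l + 1) → Fin n // IsWalkSystem E x}) (E := E)
    (ed := fun x => systemEdges x.1) (k := k) (Z := w * k + 2 * (m * l)) (R := (N : ℝ) ^ m)
    (by positivity) hQ (by omega) (by omega)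
    (fun x => x.2.card_systemEdges hl hE)
    (fun x e he => by
      obtain ⟨⟨i, j⟩, -, rfl⟩ := Finset.mem_image.1 he
      exact x.2.1 i j)
    T (fun x => hT x.1 x.2)
    (fun U hU => by
      refine le_trans (le_of_eq ?_) (card_walkSystem_le (U := U) hl hm hE (hlayer 0 (by omega)))
      norm_cast
      rw [← Finset.card_map (Function.Embedding.subtype _)]
      congr 1
      ext x
      simp [and_comm])
  rw [Fintype.card_subtype] at hfew
  have h1 : ((N : ℝ) * b ^ l / 4) ^ m ≤ 2 * 2 ^ (m * l) * C *
      (N ^ m * (((w * k + 2 * (m * l) : ℕ) : ℝ) / (m * l : ℕ)) ^ (m * l)) := by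
    refine hmany.trans (le_trans (le_of_eq ?_) hfew)
    norm_cast
  have h2 : (((w * k + 2 * (m * l) : ℕ) : ℝ) / (m * l : ℕ)) = w * k / (m * l) + 2 := by
    push_cast at hQ' ⊢
    field_simp
  rw [h2] at h1
  have hA : (0 : ℝ) ≤ (w * k / (m * l) + 2) := by positivity
  have h3 : (b : ℝ) ^ (m * l) = N ^ m * 4 ^ m * ((N : ℝ) * b ^ l / 4) ^ m / (N ^ m * N ^ m) := by
    rw [div_pow, mul_pow, ← pow_mul, mul_comm l m]
    field_simp
  rw [h3, div_le_iff₀ (by positivity)]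
  have h4 : (4 : ℝ) ^ m ≤ 4 ^ (m * l) := pow_le_pow_right₀ (by norm_num)
    (Nat.le_mul_of_pos_right m hl)
  have h5 : (2 : ℝ) ≤ 2 ^ (m * l) := by
    calc (2 : ℝ) = 2 ^ 1 := by norm_num
      _ ≤ 2 ^ (m * l) := pow_le_pow_right₀ (by norm_num) hQ
  calc (N : ℝ) ^ m * 4 ^ m * ((N : ℝ) * b ^ l / 4) ^ m
      ≤ N ^ m * 4 ^ (m * l) * (2 ^ (m * l) * 2 ^ (m * l) * C *
        (N ^ m * (w * k / (m * l) + 2) ^ (m * l))) := by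
        gcongr
        exact h1.trans (by gcongr)
    _ = _ := by
        have : (16 : ℝ) = 4 * 2 * 2 := by norm_num
        rw [this, mul_pow, mul_pow, mul_pow]
        ring

/-! ### Choice of the parameters -/

theorem card_filter_card_le_le_exp_card (s k : ℕ) :
    ((Finset.univ.filter fun P : Finset (Fin s) => P.card ≤ k).card : ℝ) ≤ Real.exp s := by
  calc ((Finset.univ.filter fun P : Finset (Fin s) => P.card ≤ k).card : ℝ)
      ≤ ((2 ^ s : ℕ) : ℝ) := by
        have := Finset.card_filter_le (Finset.univ : Finset (Finset (Fin s))) fun P => P.card ≤ k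
        rw [Finset.card_univ, Fintype.card_finset, Fintype.card_fin] at this
        exact_mod_cast this
    _ = 2 ^ s := by push_cast; rfl
    _ ≤ Real.exp 1 ^ s := by
        gcongr
        linarith [Real.add_one_le_exp (1 : ℝ)]
    _ = Real.exp s := by rw [← Real.exp_nat_mul, mul_one]

/-- The threshold for the degree `b` beyond which all powers of `log b` that occur are absorbed. -/
theorem exists_forall_log_pow_le : ∃ B : ℕ, 1 ≤ B ∧ ∀ b : ℕ, B ≤ b →
    (192 * Real.log (2 * b + 1)) ^ 4 ≤ b ∧ 11 ≤ Real.log b := by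
  have h1 : Tendsto (fun b : ℕ => (2 * b + 1 : ℝ)) atTop atTop :=
    tendsto_atTop_add_const_right _ _
      (tendsto_natCast_atTop_atTop.const_mul_atTop (by norm_num))
  have h2 := ((Real.isLittleO_pow_log_id_atTop (n := 4)).comp_tendsto h1).bound
    (show (0 : ℝ) < 1 / (3 * 192 ^ 4) by norm_num)
  have h3 := (Real.tendsto_log_atTop.comp tendsto_natCast_atTop_atTop).eventually_ge_atTop
    (11 : ℝ)
  obtain ⟨B, hB⟩ := eventually_atTop.1 ((h2.and h3).and (eventually_ge_atTop 1))
  refine ⟨max B 1, le_max_right _ _, fun b hb => ?_⟩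
  obtain ⟨⟨h4, h5⟩, h6⟩ := hB b ((le_max_left _ _).trans hb)
  refine ⟨?_, h5⟩
  have hb1 : (1 : ℝ) ≤ b := by exact_mod_cast h6
  simp only [Function.comp, id, Real.norm_eq_abs] at h4
  rw [abs_of_pos (by positivity : (0 : ℝ) < 2 * b + 1)] at h4
  have h7 := (le_abs_self _).trans h4
  rw [mul_pow]
  calc (192 : ℝ) ^ 4 * Real.log (2 * b + 1) ^ 4
      ≤ 192 ^ 4 * (1 / (3 * 192 ^ 4) * (2 * (b : ℝ) + 1)) := by
        gcongr
    _ = (2 * (b : ℝ) + 1) / 3 := by ring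
    _ ≤ (b : ℝ) := by linarith

/-- The lengths `l`, the layer sizes `N` and the numbers `m` of walks for degree `b`: the girth that
is needed is a small multiple of `log n / log b`, and the walks cover at least a
`1 / log n` fraction of the `n` vertices. -/
theorem exists_walk_parameters : ∀ᶠ n : ℕ in atTop, ∀ (α : ℝ) (b : ℕ), 1 < α →
    11 ≤ Real.log (2 * b + 1) → 6 * α * Real.log (2 * b + 1) ≤ Real.log n →
    ∃ l m N : ℕ, 0 < l ∧ 0 < m ∧ (l + 1) * N ≤ n ∧
      l * (2 * b + 1 : ℝ) ^ (⌈α * l⌉₊ + l) ≤ N / 2 ∧ m * (l + 1) ≤ (N : ℝ) / 4 ∧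
      (n : ℝ) / Real.log n ≤ m * l ∧ Real.log n / (12 * α * Real.log (2 * b + 1)) ≤ l := by
  have h2 := ((Real.isLittleO_pow_log_id_atTop (n := 4)).comp_tendsto
    (tendsto_natCast_atTop_atTop (R := ℝ))).bound (show (0 : ℝ) < 1 by norm_num)
  filter_upwards [h2, eventually_gt_atTop 1] with n hn4 hn1 α b hα hb hL
  have hn0 : (0 : ℝ) < n := by exact_mod_cast (by omega : 0 < n)
  simp only [Function.comp, id, Real.norm_eq_abs, one_mul] at hn4
  rw [abs_of_pos hn0] at hn4
  replace hn4 := (le_abs_self _).trans hn4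
  set L := Real.log n with hLdef
  set g := Real.log (2 * b + 1) with hg
  have hg0 : 0 < g := by linarith
  have hα0 : 0 < α := by linarith
  have hL66 : 66 ≤ L := by nlinarith
  set z := L / (6 * α * g) with hz
  have hz1 : 1 ≤ z := by rw [hz, le_div_iff₀ (by positivity)]; linarith
  set l := ⌊z⌋₊ with hl
  have hl1 : 1 ≤ l := (Nat.one_le_floor_iff z).2 hz1
  have hl1' : (1 : ℝ) ≤ l := by exact_mod_cast hl1
  have hlz : (l : ℝ) ≤ z := Nat.floor_le (by linarith)
  have hzl : z < l + 1 := Nat.lt_floor_add_one z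
  have hlag : 6 * α * g * l ≤ L := by
    calc 6 * α * g * l ≤ 6 * α * g * z := by gcongr
      _ = L := by rw [hz]; field_simp
  have hlg : 6 * g * l ≤ L := by
    refine le_trans ?_ hlag
    have : 0 < g * l := by positivity
    nlinarith
  have hl66 : 66 * (l : ℝ) ≤ L := by nlinarith
  set r := Real.exp (L / 2) with hr
  have hrn : r * r = n := by
    rw [hr, ← Real.exp_add, add_halves, hLdef, Real.exp_log hn0]
  have hr0 : 0 < r := Real.exp_pos _
  have hLr : L ^ 2 ≤ r := by
    have : (L ^ 2) ^ 2 ≤ r ^ 2 := by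
      calc (L ^ 2) ^ 2 = L ^ 4 := by ring
        _ ≤ (n : ℝ) := hn4
        _ = r ^ 2 := by rw [← hrn]; ring
    exact le_of_sq_le_sq this hr0.le
  have hlr : 66 * 66 * (l : ℝ) ^ 2 ≤ r := by
    refine le_trans ?_ hLr
    nlinarith
  have hll : (l : ℝ) ≤ l ^ 2 := by nlinarith
  -- the layers
  set N := n / (l + 1) with hN
  have hNn : (n : ℝ) < (l + 1) * (N + 1) := by
    have := Nat.lt_mul_div_succ n (show 0 < l + 1 by omega)
    exact_mod_cast this
  have hN4 : (n : ℝ) ≤ 4 * l * N := by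
    have h1 : (n : ℝ) < 2 * l * N + 2 * l := by
      have : (0 : ℝ) ≤ N := N.cast_nonneg
      nlinarith
    have h2 : 4 * (l : ℝ) ≤ n := by
      rw [← hrn]; nlinarith
    linarith
  have hrlN : 8 * (l : ℝ) * r ≤ 4 * N := by
    have h1 : r * r ≤ 4 * l * N := hrn ▸ hN4
    have h2 : l * (8 * l * r) ≤ l * (4 * (N : ℝ)) := by
      calc l * (8 * l * r) = 8 * l ^ 2 * r := by ring
        _ ≤ r * r := by gcongr; nlinarith
        _ ≤ l * (4 * N) := by linarith
    exact le_of_mul_le_mul_left h2 (by linarith)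
  have hN8 : 8 * (l : ℝ) ≤ N := by nlinarith
  -- the number of walks
  set m := N / (4 * (l + 1)) with hm
  have hmN : (m : ℝ) * (4 * (l + 1)) ≤ N := by
    exact_mod_cast Nat.div_mul_le_self N (4 * (l + 1))
  have hm1 : 1 ≤ m := by
    rw [hm, Nat.one_le_div_iff (by omega)]
    have : 8 * l ≤ N := by exact_mod_cast hN8
    omega
  have hm1' : (1 : ℝ) ≤ m := by exact_mod_cast hm1
  have hNm : (N : ℝ) < 4 * (l + 1) * (m + 1) := by
    have := Nat.lt_mul_div_succ N (show 0 < 4 * (l + 1) by omega)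
    exact_mod_cast this
  have hN16 : (N : ℝ) ≤ 16 * (m * l) := by nlinarith
  refine ⟨l, m, N, hl1, hm1, Nat.mul_div_le _ _, ?_, by linarith, ?_, ?_⟩
  · have hceil : ((⌈α * l⌉₊ + l : ℕ) : ℝ) ≤ 3 * α * l := by
      have := Nat.ceil_lt_add_one (show 0 ≤ α * (l : ℝ) by positivity)
      push_cast
      nlinarith
    have hpow : (2 * b + 1 : ℝ) ^ (⌈α * l⌉₊ + l) ≤ r := by
      calc (2 * b + 1 : ℝ) ^ (⌈α * l⌉₊ + l) = Real.exp ((⌈α * l⌉₊ + l : ℕ) * g) := by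
            rw [Real.exp_nat_mul, hg, Real.exp_log (by positivity)]
        _ ≤ r := by
            apply Real.exp_le_exp.2
            calc ((⌈α * l⌉₊ + l : ℕ) : ℝ) * g ≤ 3 * α * l * g := by gcongr
              _ ≤ L / 2 := by linarith
    have : l * (2 * b + 1 : ℝ) ^ (⌈α * l⌉₊ + l) ≤ l * r := by gcongr
    linarith
  · rw [div_le_iff₀ (by linarith)]
    calc (n : ℝ) ≤ 4 * l * N := hN4
      _ ≤ 4 * l * (16 * (m * l)) := by gcongr
      _ = m * l * (64 * l) := by ring
      _ ≤ m * l * L := by gcongr; linarith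
  · have : L / (12 * α * g) = z / 2 := by rw [hz]; field_simp; norm_num
    rw [this]
    linarith

/-- The degree `b` is a polynomial in `μ`, so large that its logarithm can be absorbed. -/
theorem sq_le_degree {b : ℕ} {μ : ℝ} (hμ : 0 ≤ μ) (hb : (1 + μ) ^ 4 ≤ (b : ℝ))
    (hlog : (192 * Real.log (2 * b + 1)) ^ 4 ≤ b) (hlog1 : 1 ≤ Real.log (2 * b + 1)) :
    (16 * (12 * Real.log (2 * b + 1) * μ + 2)) ^ 2 ≤ (b : ℝ) := by
  set g := Real.log (2 * b + 1)
  have h1 : 16 * (12 * g * μ + 2) ≤ 192 * g * (1 + μ) := by nlinarith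
  have h2 : (16 * (12 * g * μ + 2)) ^ 2 ≤ (192 * g * (1 + μ)) ^ 2 := by gcongr
  refine h2.trans (le_of_sq_le_sq ?_ (Nat.cast_nonneg b))
  calc ((192 * g * (1 + μ)) ^ 2) ^ 2 = (192 * g) ^ 4 * (1 + μ) ^ 4 := by ring
    _ ≤ (b : ℝ) * b := by gcongr
    _ = (b : ℝ) ^ 2 := by ring

/-- If `x` is at most the square root of `b`, then half of the exponent of `b` survives. -/
theorem exp_le_of_pow_le_mul_pow {b Q : ℕ} {C x : ℝ} (hb : 0 < b) (hC : 0 ≤ C) (hx : 0 ≤ x)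
    (hxb : x ^ 2 ≤ b) (h : (b : ℝ) ^ Q ≤ C * x ^ Q) : Real.exp (Q / 2 * Real.log b) ≤ C := by
  have hb' : (0 : ℝ) < b := by exact_mod_cast hb
  set r := Real.sqrt b with hr
  have hr0 : 0 < r := Real.sqrt_pos.2 hb'
  have hrr : r * r = b := Real.mul_self_sqrt hb'.le
  have hxr : x ≤ r := Real.le_sqrt_of_sq_le hxb
  have h1 : r ^ Q * r ^ Q ≤ C * r ^ Q := by
    rw [← mul_pow, hrr]
    exact h.trans (by gcongr)
  have h2 : r ^ Q ≤ C := le_of_mul_le_mul_right h1 (by positivity)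
  refine le_trans (le_of_eq ?_) h2
  rw [← Real.exp_log hr0, ← Real.exp_nat_mul, hr, Real.log_sqrt hb'.le]
  congr 1; ring

/-- If the table has at most `K * (m * l)` cells and the certificates of `m` queries
have at least `b ^ (m * l / 2)` possible positions, then each of them consists of many cells. -/
theorem mul_log_le_of_exp_le_card {s t m l b : ℕ} {K : ℝ} (hm : 0 < m) (hl : 0 < l)
    (hK : 1 ≤ Real.log K) (hK0 : 0 < K) (hb : 4 ≤ Real.log b) (hs : s ≤ K * (m * l))
    (hcard : Real.exp ((m * l : ℕ) / 2 * Real.log b) ≤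
      (Finset.univ.filter fun P : Finset (Fin s) => P.card ≤ min (t * m) s).card) :
    (l : ℝ) / 4 * Real.log b ≤ t * Real.log K := by
  have hm' : (0 : ℝ) < m := by exact_mod_cast hm
  have hl' : (0 : ℝ) < l := by exact_mod_cast hl
  have ht0 : (0 : ℝ) ≤ t := t.cast_nonneg
  rcases le_or_gt s (t * m) with h | h
  · have h1 := Real.exp_le_exp.1 (hcard.trans (card_filter_card_le_le_exp_card _ _))
    have h2 : (s : ℝ) ≤ t * m := by exact_mod_cast h
    push_cast at h1
    have h3 : m * ((l : ℝ) / 2 * Real.log b) ≤ m * t := by linarith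
    have h4 := le_of_mul_le_mul_left h3 hm'
    nlinarith
  · rw [min_eq_left h.le] at hcard
    rcases Nat.eq_zero_or_pos t with rfl | ht
    · have h1 : (Finset.univ.filter fun P : Finset (Fin s) => P.card ≤ 0 * m) = {∅} := by
        ext P; simp
      rw [h1, Finset.card_singleton, Nat.cast_one, Real.exp_le_one_iff] at hcard
      have : 0 < ((m * l : ℕ) : ℝ) / 2 * Real.log b := by
        push_cast
        have : 0 < Real.log b := by linarith
        positivity
      linarith
    · have ht' : (0 : ℝ) < t := by exact_mod_cast ht
      have h1 := Real.exp_le_exp.1 (hcard.trans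
        (card_filter_card_le_le_exp (Nat.mul_pos ht hm) h.le))
      push_cast at h1
      have hs0 : (0 : ℝ) < s := by exact_mod_cast (Nat.zero_le _).trans_lt h
      have h2 : Real.log (s / (t * m)) ≤ Real.log K + (l / t - 1) := by
        calc Real.log (s / (t * m)) ≤ Real.log (K * (l / t)) := by
              apply Real.log_le_log (by positivity)
              rw [div_le_iff₀ (by positivity)]
              refine hs.trans (le_of_eq ?_)
              field_simp
          _ = Real.log K + Real.log (l / t) := Real.log_mul hK0.ne' (by positivity)
          _ ≤ _ := by
              gcongr
              exact Real.log_le_sub_one_of_pos (by positivity)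
      have h3 : m * ((l : ℝ) / 2 * Real.log b) ≤ m * (t * Real.log K + l) := by
        calc m * ((l : ℝ) / 2 * Real.log b) = m * l / 2 * Real.log b := by ring
          _ ≤ t * m * (1 + Real.log (s / (t * m))) := h1
          _ ≤ t * m * (1 + (Real.log K + (l / t - 1))) := by gcongr
          _ = m * (t * Real.log K + l) := by field_simp; ring
      have h4 := le_of_mul_le_mul_left h3 hm'
      nlinarith

/-- The numerical part of the lower bound. A table of at most `3 * n / log n` cells has too few sets
of cells altogether, whatever `t` is. Otherwise `t` may be assumed to be less than
`log n / α`, so that the certificates read few bits. -/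
theorem lower_bound_of_exp_le_card {n s w t m l b : ℕ} {α μ : ℝ} (hα : 1 < α)
    (hl : 0 < l) (hm : 0 < m) (hn0 : 0 < n) (hL : 0 < Real.log n)
    (hQ : (n : ℝ) / Real.log n ≤ m * l)
    (hlL : Real.log n / (12 * α * Real.log (2 * b + 1)) ≤ l) (hb : 11 ≤ Real.log b)
    (hμ : μ = min (t * w * α / Real.log n) w)
    (hcount : (w : ℝ) * min (t * m) s / (m * l) ≤ 12 * Real.log (2 * b + 1) * μ →
      Real.exp ((m * l : ℕ) / 2 * Real.log b) ≤
        (Finset.univ.filter fun P : Finset (Fin s) => P.card ≤ min (t * m) s).card) :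
    0 < Real.log (s * Real.log n / n) ∧
      1 / 96 * (Real.log n / (α * Real.log (s * Real.log n / n))) ≤ t := by
  have hn0' : (0 : ℝ) < n := by exact_mod_cast hn0
  have hm' : (0 : ℝ) < m := by exact_mod_cast hm
  have hl' : (0 : ℝ) < l := by exact_mod_cast hl
  have hα0 : 0 < α := by linarith
  have hb1 : (1 : ℝ) < b := by
    by_contra! h
    have := Real.log_nonpos (Nat.cast_nonneg b) h
    linarith
  set L := Real.log n with hLdef
  set g := Real.log (2 * b + 1) with hg
  set K := s * L / n with hK
  have hgb : Real.log b ≤ g := Real.log_le_log (by linarith) (by linarith)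
  have hgb2 : g ≤ 2 * Real.log b := by
    rw [hg, ← Nat.cast_two, ← Real.log_pow, Nat.cast_two]
    apply Real.log_le_log (by linarith)
    have : (3 : ℝ) ≤ b := by
      have := Real.log_le_sub_one_of_pos (show (0 : ℝ) < b by linarith)
      linarith
    nlinarith
  have hg0 : 0 < g := by linarith
  have hK0 : 0 ≤ K := by positivity
  have hs : (s : ℝ) ≤ K * (m * l) := by
    calc (s : ℝ) = K * (n / L) := by rw [hK]; field_simp
      _ ≤ K * (m * l) := by gcongr
  set k := min (t * m) s with hk
  have hkt : (k : ℝ) ≤ t * m := by exact_mod_cast min_le_left (t * m) s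
  have hks : (k : ℝ) ≤ s := by exact_mod_cast min_le_right (t * m) s
  have hw0 : (0 : ℝ) ≤ w := w.cast_nonneg
  -- the number of bits read by all certificates together
  have hwkD : (w : ℝ) * k / (m * l) ≤ 12 * g * (t * w * α / L) := by
    calc (w : ℝ) * k / (m * l) ≤ w * (t * m) / (m * l) := by gcongr
      _ = w * t / l := by field_simp
      _ ≤ w * t / (L / (12 * α * g)) := by gcongr
      _ = _ := by field_simp
  have hlogK : 1 < Real.log K := by
    by_contra! hK1
    have hK3 : K ≤ 3 := by
      rcases hK0.eq_or_lt with h | h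
      · rw [← h]; norm_num
      · have := (Real.log_le_iff_le_exp h).1 hK1
        linarith [Real.exp_one_lt_d9]
    have hs3 : (s : ℝ) ≤ 3 * (m * l) := hs.trans (by gcongr)
    have hwkw : (w : ℝ) * k / (m * l) ≤ 12 * g * w := by
      rw [div_le_iff₀ (by positivity)]
      calc (w : ℝ) * k ≤ w * (3 * (m * l)) := by gcongr; exact hks.trans hs3
        _ ≤ 12 * g * w * (m * l) := by
          have : 3 ≤ 12 * g := by linarith
          calc (w : ℝ) * (3 * (m * l)) = 3 * (w * (m * l)) := by ring
            _ ≤ 12 * g * (w * (m * l)) := by gcongr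
            _ = _ := by ring
    have h1 := hcount (by
      rw [hμ, mul_min_of_nonneg _ _ (by positivity)]
      exact le_min hwkD hwkw)
    have h2 := Real.exp_le_exp.1 (h1.trans (card_filter_card_le_le_exp_card _ _))
    push_cast at h2
    have h3 : (m : ℝ) * l * (Real.log b / 2) ≤ m * l * 3 := by linarith
    have h4 := le_of_mul_le_mul_left h3 (by positivity)
    linarith
  refine ⟨by linarith, ?_⟩
  by_contra! ht
  have hK0' : 0 < K := by
    rcases hK0.eq_or_lt with h | h
    · rw [← h, Real.log_zero] at hlogK
      linarith
    · exact h
  have ht' : (t : ℝ) * Real.log K < L / (96 * α) := by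
    calc (t : ℝ) * Real.log K < 1 / 96 * (L / (α * Real.log K)) * Real.log K := by
          gcongr
      _ = L / (96 * α) := by field_simp
  -- hence the certificates read few bits, and the counting bound applies
  have hDw : t * w * α / L ≤ w := by
    rw [div_le_iff₀ hL]
    have h1 : (t : ℝ) ≤ t * Real.log K := by
      have : (0 : ℝ) ≤ t := t.cast_nonneg
      nlinarith
    have h2 : (t : ℝ) * α ≤ L := by
      have h3 := h1.trans ht'.le
      rw [le_div_iff₀ (by positivity)] at h3
      have : (0 : ℝ) ≤ t * α := by positivity
      nlinarith
    calc (t : ℝ) * w * α = w * (t * α) := by ring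
      _ ≤ w * L := by gcongr
  have h1 := hcount (by rw [hμ, min_eq_left hDw]; exact hwkD)
  have h2 := mul_log_le_of_exp_le_card hm hl hlogK.le hK0' (by linarith) hs h1
  -- `l ≥ L / (12 * α * g)` and `log b ≥ g / 2` account for the constant `96 = 4 * 12 * 2`
  have h3 : L / (96 * α) ≤ l / 4 * Real.log b := by
    calc L / (96 * α) = L / (12 * α * g) * (g / 8) := by field_simp; norm_num
      _ ≤ l * (g / 8) := by gcongr
      _ ≤ l * (2 * Real.log b / 8) := by gcongr
      _ = l / 4 * Real.log b := by ring
  linarith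

/-- The lower bound for one value of `n`, given suitable parameters of the hard instances. -/
theorem lower_bound_of_hasCertificates {n s w t m l b N : ℕ} {α Δ μ : ℝ} (hα : 1 < α)
    (hl : 0 < l) (hm : 0 < m) (hn0 : 0 < n) (hL : 0 < Real.log n) (hn : (l + 1) * N ≤ n)
    (hΔ : 2 * b ≤ Δ) (hN : l * (2 * b + 1 : ℝ) ^ (⌈α * l⌉₊ + l) ≤ N / 2)
    (hmN : m * (l + 1) ≤ (N : ℝ) / 4) (hQ : (n : ℝ) / Real.log n ≤ m * l)
    (hlL : Real.log n / (12 * α * Real.log (2 * b + 1)) ≤ l) (hb : 11 ≤ Real.log b)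
    (hμ : μ = min (t * w * α / Real.log n) w)
    (hbμ : (16 * (12 * Real.log (2 * b + 1) * μ + 2)) ^ 2 ≤ (b : ℝ))
    (hcert : HasCertificates (approxDistanceOracle α (boundedDegreeGraphs n Δ)) s w t) :
    0 < Real.log (s * Real.log n / n) ∧
      1 / 96 * (Real.log n / (α * Real.log (s * Real.log n / n))) ≤ t := by
  refine lower_bound_of_exp_le_card hα hl hm hn0 hL hQ hlL hb hμ fun h => ?_
  have hb0 : 0 < b := by
    rcases Nat.eq_zero_or_pos b with rfl | h
    · norm_num at hb
    · exact h
  refine exp_le_of_pow_le_mul_pow hb0 (Nat.cast_nonneg _) (by positivity) (le_trans ?_ hbμ)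
    (pow_le_card_positions hα hl hm hn hΔ hN hmN hcert)
  gcongr

theorem mainTheorem6 :
    ∃ c : ℝ, 0 < c ∧ ∃ p : Polynomial ℝ,
      ∀ (α : ℕ → ℝ) (w : ℕ → ℕ), (∀ n, 1 < α n) →
        (α =o[atTop] fun n : ℕ => Real.log n / Real.log (w n * Real.log n)) →
        ∀ᶠ n : ℕ in atTop, ∀ s t : ℕ,
          (HasCertificates
              (approxDistanceOracle (α n) (Set.univ : Set (SimpleGraph (Fin n)))) s (w n) t →
            0 < Real.log (s * Real.log n / n) ∧
              c * (Real.log n / (α n * Real.log (s * Real.log n / n))) ≤ t) ∧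
          (HasCertificates
              (approxDistanceOracle (α n)
                (boundedDegreeGraphs n (p.eval (t * w n * α n / Real.log n)))) s (w n) t →
            0 < Real.log (s * Real.log n / n) ∧
              c * (Real.log n / (α n * Real.log (s * Real.log n / n))) ≤ t) := by
  obtain ⟨B, hB1, hB⟩ := exists_forall_log_pow_le
  have hB1' : (1 : ℝ) ≤ B := by exact_mod_cast hB1
  refine ⟨1 / 96, by norm_num, Polynomial.C (4 * (B : ℝ)) * (1 + Polynomial.X) ^ 4, ?_⟩
  intro α w hα hαo
  have hlog : Tendsto (fun n : ℕ => Real.log n) atTop atTop :=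
    Real.tendsto_log_atTop.comp tendsto_natCast_atTop_atTop
  filter_upwards [hαo.bound (show (0 : ℝ) < 1 / 24 by norm_num), exists_walk_parameters,
    hlog.eventually_ge_atTop (80 * B), eventually_gt_atTop 0] with n hbound hparam hLB hn0
  -- graphs of bounded degree suffice
  suffices h : ∀ s t : ℕ, HasCertificates (approxDistanceOracle (α n) (boundedDegreeGraphs n
      ((Polynomial.C (4 * (B : ℝ)) * (1 + Polynomial.X) ^ 4).eval
        (t * w n * α n / Real.log n)))) s (w n) t →
      0 < Real.log (s * Real.log n / n) ∧
        1 / 96 * (Real.log n / (α n * Real.log (s * Real.log n / n))) ≤ t from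
    fun s t => ⟨fun hc => h s t (hc.mono_graphs (Set.subset_univ _)), h s t⟩
  intro s t hcert
  have hα1 := hα n
  set L := Real.log n with hL
  have hL80 : 80 ≤ L := by linarith
  have hw1 : 1 ≤ w n := by
    -- the growth hypothesis excludes `w n = 0` because of `log 0 = 0` and `L / 0 = 0`
    by_contra! h
    have h0 : w n = 0 := by omega
    rw [h0] at hbound
    simp only [Nat.cast_zero, zero_mul, Real.log_zero, div_zero, norm_zero, mul_zero] at hbound
    have := (le_abs_self (α n)).trans hbound
    linarith
  have hw1' : (1 : ℝ) ≤ w n := by exact_mod_cast hw1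
  have hwL : 1 < w n * L := by nlinarith
  have hlogwL : 0 < Real.log (w n * L) := Real.log_pos hwL
  have hαL : 24 * α n * Real.log (w n * L) ≤ L := by
    rw [Real.norm_eq_abs, Real.norm_eq_abs, abs_of_pos (by linarith),
      abs_of_pos (by positivity : 0 < L / Real.log (w n * L))] at hbound
    rw [mul_div_assoc', le_div_iff₀ hlogwL] at hbound
    linarith
  set D := t * w n * α n / L with hD
  have hD0 : 0 ≤ D := by positivity
  set μ := min D (w n : ℝ) with hμ
  have hμ0 : 0 ≤ μ := le_min hD0 (by linarith)
  have hμ1 : 1 ≤ (1 + μ) ^ 4 := one_le_pow₀ (by linarith)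
  set b := ⌈(B : ℝ) * (1 + μ) ^ 4⌉₊ with hb
  have hbge : (B : ℝ) * (1 + μ) ^ 4 ≤ b := Nat.le_ceil _
  have hble : (b : ℝ) ≤ 2 * B * (1 + μ) ^ 4 := by
    have := Nat.ceil_lt_add_one (show 0 ≤ (B : ℝ) * (1 + μ) ^ 4 by positivity)
    nlinarith
  have hBb : B ≤ b := by
    have : (B : ℝ) ≤ b := le_trans (by nlinarith) hbge
    exact_mod_cast this
  obtain ⟨hb4, hb11⟩ := hB b hBb
  have hb1 : (1 : ℝ) ≤ b := by exact_mod_cast hB1.trans hBb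
  have hg11 : 11 ≤ Real.log (2 * b + 1) :=
    hb11.trans (Real.log_le_log (by linarith) (by linarith))
  have hg : Real.log (2 * b + 1) ≤ 4 * Real.log (w n * L) := by
    rw [show (4 : ℝ) = (4 : ℕ) by norm_num, ← Real.log_pow]
    apply Real.log_le_log (by positivity)
    calc (2 * b + 1 : ℝ) ≤ 5 * B * (1 + μ) ^ 4 := by nlinarith
      _ ≤ 5 * B * (2 * w n) ^ 4 := by
          gcongr
          linarith [min_le_right D (w n : ℝ)]
      _ = 80 * B * (w n) ^ 4 := by ring
      _ ≤ L ^ 4 * (w n) ^ 4 := by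
          gcongr
          refine hLB.trans (le_self_pow₀ (by linarith) (by norm_num))
      _ = (w n * L) ^ 4 := by ring
  obtain ⟨l, m, N, hl, hm, hn, hN, hmN, hQ, hlL⟩ := hparam (α n) b hα1 hg11 (by
    refine le_trans ?_ hαL
    calc 6 * α n * Real.log (2 * b + 1) ≤ 6 * α n * (4 * Real.log (w n * L)) := by gcongr
      _ = _ := by ring)
  refine lower_bound_of_hasCertificates hα1 hl hm hn0 (by linarith) hn ?_ hN hmN hQ hlL hb11 hμ
    (sq_le_degree hμ0 (le_trans (by nlinarith) hbge) hb4 (by linarith)) hcert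
  simp only [Polynomial.eval_mul, Polynomial.eval_C, Polynomial.eval_pow, Polynomial.eval_add,
    Polynomial.eval_one, Polynomial.eval_X]
  calc (2 * b : ℝ) ≤ 2 * (2 * B * (1 + μ) ^ 4) := by gcongr
    _ ≤ 2 * (2 * B * (1 + D) ^ 4) := by
        gcongr
        exact min_le_left _ _
    _ = 4 * B * (1 + D) ^ 4 := by ring
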